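/- Setting. Let $\ell_2$ be the Hilbert space of square-summable real sequences. A differentiable $h:\ell_2\to\mathbb R$ is $L$-smooth if $\|\nabla h(y)-\nabla h(x)\|\le L\|y-x\|$ for all $x,y$, and $\mu$-strongly convex if $h(y)\ge h(x)+\langle\nabla h(x),y-x\rangle+\frac\mu2\|y-x\|^2$ for all $x,y$. A decentralized time-varying problem $\mathcal P$ consists of connected undirected graphs $G_1,G_2,\dots$ on the vertex set $\{1,\dots,n\}$, $G_r$ being the network in the $r$-th communication round, and of functions $f_1,\dots,f_n:\ell_2\to\mathbb R$, each smooth and strongly convex with some constants of its own. Its global function is $f=\frac1n\sum_i f_i$; $\mathcal P$ is called $L$-smooth ($\mu$-strongly convex) if $f$ is. Put $\chi(\mathcal P)=\sup_r\lambda_{\max}(\mathcal L(G_r))/\lambda^+_{\min}(\mathcal L(G_r))$, where $\mathcal L(G)$ is the graph Laplacian and $\lambda_{\max},\lambda_{\min}^+$ are its largest and its smallest nonzero eigenvalue, and let $\Delta(\mathcal P)=\max_r|E(G_r)\,\triangle\,E(G_{r+1})|$. Let $x_*$ be the minimizer of $f$. A first-order decentralized algorithm on $\mathcal P$, started at $x_0=0$,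 maintains local memories $H_i(p)\subseteq\ell_2$ ($p=0,1,2,\dots$) with $H_i(0)=\{0\}$. Every time step is either a local computation, in which $H_i(p+1)\subseteq\operatorname{span}\{x,\nabla f_i(x),\nabla f_i^*(x):x\in H_i(p)\}$ for all $i$ (with $f_i^*$ the convex conjugate), or a communication round, in which $H_i(p+1)\subseteq\operatorname{span}\bigcup_j H_j(p)$ for all $i$, where $j$ runs over $i$ and its neighbours in $G_r$ if this is the $r$-th communication round. Here $x_p$ denotes any element of $\bigcup_i H_i(p)$. Theorem. For all $\alpha,c>0$ there are constants $K,C>0$ and $\varepsilon_0\in(0,1)$, depending only on $\alpha$ and $c$, such that for all $L\ge\mu>0$ and $M>0$ there is an $L$-smooth, $\mu$-strongly convex decentralized time-varying problem $\mathcal P$ with $n>M$, $\chi=\chi(\mathcal P)>M$, $\Delta(\mathcal P)\le c\,n^\alpha$ and $x_*\ne x_0=0$, for which every first-order decentralized algorithm started at $x_0$ satisfies the following. (i) For every number $p$ of time steps and every $x_p$, $$\|x_p-x_*\|^2\ \ge\ \Bigl(\max\Bigl\{0,\,1-2\sqrt6\sqrt{\tfrac{\mu}{L}}\Bigr\}\Bigr)^{Kp/\chi+2}\,\|x_0-x_*\|^2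 .$$ (ii) If moreover $L/\mu>24$, then for every $0<\varepsilon<\varepsilon_0$, whenever $\|x_p-x_*\|^2\le\varepsilon\|x_0-x_*\|^2$, the first $p$ time steps contain at least $C\,\chi\sqrt{L/\mu}\,\log(1/\varepsilon)$ communication rounds; that is, $\Omega\bigl(\chi\sqrt{L/\mu}\log(1/\varepsilon)\bigr)$ communication rounds are needed. -/

import Mathlib

open scoped InnerProductSpace

noncomputable section

namespace DecOpt

/-- The Hilbert space `ℓ₂` of square-summable real sequences. -/
abbrev EllTwo : Type := lp (fun _ : ℕ => ℝ) 2

section Functions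

variable {H : Type*} [NormedAddCommGroup H] [InnerProductSpace ℝ H] [CompleteSpace H]

/-- `h` is `L`-smooth: differentiable with an `L`-Lipschitz gradient. -/
def IsSmooth (L : ℝ) (h : H → ℝ) : Prop :=
  Differentiable ℝ h ∧ ∀ x y : H, ‖gradient h y - gradient h x‖ ≤ L * ‖y - x‖

/-- `h` is (differentiable and) `μ`-strongly convex. -/
def IsStronglyConvex (μ : ℝ) (h : H → ℝ) : Prop :=
  Differentiable ℝ h ∧
    ∀ x y : H, h x + ⟪gradient h x, y - x⟫_ℝ + μ / 2 * ‖y - x‖ ^ 2 ≤ h y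

/-- The convex conjugate `h^*(y) = sup_x (⟨y, x⟩ - h x)`. It is only used for strongly convex `h`,
for which the supremum is finite and `h^*` is differentiable on the whole space. -/
def conjugate (h : H → ℝ) (y : H) : ℝ :=
  ⨆ x : H, (⟪y, x⟫_ℝ - h x)

end Functions

/-- Condition number `λ_max / λ_min⁺` of a symmetric positive semidefinite matrix: its largest
eigenvalue divided by its smallest nonzero eigenvalue. -/
def matrixCond {ι : Type*} [Fintype ι] [DecidableEq ι] (A : Matrix ι ι ℝ) : ℝ :=
  sSup (spectrum ℝ A) / sInf {t : ℝ | t ∈ spectrum ℝ A ∧ t ≠ 0}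

open Classical in
/-- Condition number of the Laplacian of a graph. -/
def graphCond {n : ℕ} (G : SimpleGraph (Fin n)) : ℝ :=
  matrixCond (G.lapMatrix ℝ)

/-- A decentralized time-varying problem: a sequence of connected undirected graphs on the common
vertex set `Fin n` (`graph r` is the network of the communication round number `r`, rounds being
numbered from `0`), and one objective function on `ℓ₂` for each vertex. The local functions have
Lipschitz gradients and are strongly convex, each with some constants of its own, so that both
gradient oracles `∇ f_i` and `∇ f_i^*` are well defined everywhere. -/
structure Problem where
  n : ℕ
  graph : ℕ → SimpleGraph (Fin n)
  connected : ∀ r, (graph r).Connected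
  f : Fin n → EllTwo → ℝ
  f_smooth : ∀ i, ∃ l : ℝ, IsSmooth l (f i)
  f_stronglyConvex : ∀ i, ∃ s : ℝ, 0 < s ∧ IsStronglyConvex s (f i)

namespace Problem

/-- The global function `f = (1/n) ∑ f_i`. -/
def objective (P : Problem) (x : EllTwo) : ℝ :=
  (1 / (P.n : ℝ)) * ∑ i, P.f i x

/-- `χ = sup_r χ(G_r)` (a supremum over finitely many values). -/
def chi (P : Problem) : ℝ :=
  ⨆ r : ℕ, graphCond (P.graph r)

/-- The largest number of edges that change between two consecutive communication rounds
(a maximum of a bounded family of natural numbers). -/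
def edgeChange (P : Problem) : ℕ :=
  ⨆ r : ℕ, (symmDiff (P.graph r).edgeSet (P.graph (r + 1)).edgeSet).ncard

end Problem

open Classical in
/-- The number of communication rounds among the time steps `0, …, k - 1`, where `comm k` says that
time step `k` is a communication round. -/
def roundsBefore (comm : ℕ → Prop) (k : ℕ) : ℕ :=
  Nat.count comm k

/-- A (run of a) first-order decentralized algorithm on the problem `P`, started at `0`. At every
time step `k` the nodes either communicate or perform a local computation; `mem k i` is the local
memory of node `i` after `k` time steps. The algorithm may choose the types of the steps and the
memories in any way which satisfies the inclusions below. -/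
structure Algorithm (P : Problem) where
  comm : ℕ → Prop
  mem : ℕ → Fin P.n → Set EllTwo
  mem_zero : ∀ i, mem 0 i = {0}
  mem_local : ∀ k, ¬ comm k → ∀ i,
    mem (k + 1) i ⊆ Submodule.span ℝ
      {z : EllTwo | ∃ x ∈ mem k i,
        z = x ∨ z = gradient (P.f i) x ∨ z = gradient (conjugate (P.f i)) x}
  mem_comm : ∀ k, comm k → ∀ i,
    mem (k + 1) i ⊆ Submodule.span ℝ
      {z : EllTwo | ∃ j, (j = i ∨ (P.graph (roundsBefore comm k)).Adj i j) ∧ z ∈ mem k j}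

/-- The number of communication rounds used during the first `p` time steps. -/
def Algorithm.rounds {P : Problem} (A : Algorithm P) (p : ℕ) : ℕ :=
  roundsBefore A.comm p

end DecOpt

end

/-! The objective is Nesterov's tridiagonal quadratic: `μ/2 ‖x‖²` plus `κ/2 ∑ (x i - x (i+1))²` plus
a linear term in the first coordinate, with `κ = (L - μ)/4`. Its minimizer is a geometric sequence
`ρ ^ i`, where `1 - ρ` is of order `√(μ/L)`; a vector supported on the first `N` coordinates
therefore has squared error at least `ρ ^ (2N) ‖x_*‖²` (`dist_geometric_ge`). The couplings of
neighbouring coordinates are split by parity between two vertices, the sources, and all other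
vertices hold `μ/2 ‖x‖²`. Both oracles of a source open a new coordinate only for one parity of `N`,
so progress requires information to travel back and forth between the sources.

The network makes each trip take a number `R` of rounds proportional to `n = k ^ d`, although few
edges change. It is a tree of depth `d` on the base-`k` numbers below `k ^ d`, on which the vertices
are rearranged. The positions of informed vertices lie in an interval `[j, e)`; its outside
neighbours are among the at most `d` truncations of `j` (`exists_eq_truncate_of_adj`). After each
round the vertices at these truncations are moved into the `d` places just below `j`, so the
interval grows by `d` only (`Informed.of_adj`). At most `2d` vertices move, each of degree `O(dk)`,
so `O(d² k)` edges change, which is below `c n ^ α` once `d ≥ 2/α` and `k` is large.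

Degrees `O(dk)` and a Poincaré inequality with constant `2 d² k ^ (d - 1)` give `χ = O(d³ n) = O(d⁴
R)`. By the invariant `mem_firstCoords_of_mem_mem`, `r` rounds open at most `r / R + 1` coordinates,
and both claims follow by taking powers or logarithms. -/

open scoped InnerProductSpace

noncomputable section

namespace DecOpt

/-! ### Quadratic functions on a Hilbert space and their two gradient oracles -/

section Quadratic

variable {H : Type*} [NormedAddCommGroup H] [InnerProductSpace ℝ H]

/-- The quadratic function `x ↦ ⟪A x, x⟫ / 2 - ⟪v, x⟫`. -/
def quadratic (A : H →L[ℝ] H) (v x : H) : ℝ :=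
  1 / 2 * ⟪A x, x⟫_ℝ - ⟪v, x⟫_ℝ

theorem quadratic_expand {A : H →L[ℝ] H} (hA : ∀ x y, ⟪A x, y⟫_ℝ = ⟪x, A y⟫_ℝ) (v x y : H) :
    quadratic A v y = quadratic A v x + ⟪A x - v, y - x⟫_ℝ + 1 / 2 * ⟪A (y - x), y - x⟫_ℝ := by
  have h1 : ⟪A y, x⟫_ℝ = ⟪A x, y⟫_ℝ := by rw [hA, real_inner_comm]
  simp only [quadratic, map_sub, inner_sub_left, inner_sub_right, h1]
  ring

theorem quadratic_le_of_apply_eq {A : H →L[ℝ] H} (hA : ∀ x y, ⟪A x, y⟫_ℝ = ⟪x, A y⟫_ℝ)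
    (hpos : ∀ x, 0 ≤ ⟪A x, x⟫_ℝ) {v x : H} (hx : A x = v) (y : H) :
    quadratic A v x ≤ quadratic A v y := by
  rw [quadratic_expand hA v x y, hx, sub_self, inner_zero_left]
  linarith [hpos (y - x)]

/-- The conjugate of a positive invertible quadratic function. -/
theorem conjugate_quadratic {A B : H →L[ℝ] H} (hA : ∀ x y, ⟪A x, y⟫_ℝ = ⟪x, A y⟫_ℝ)
    (hpos : ∀ x, 0 ≤ ⟪A x, x⟫_ℝ) (hAB : ∀ x, A (B x) = x) (v y : H) :
    conjugate (quadratic A v) y = 1 / 2 * ⟪B (y + v), y + v⟫_ℝ := by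
  have key : ∀ x, ⟪y, x⟫_ℝ - quadratic A v x = - quadratic A (y + v) x := by
    intro x
    simp only [quadratic, inner_add_left]
    ring
  have hmin : ∀ x, - quadratic A (y + v) x ≤ - quadratic A (y + v) (B (y + v)) := fun x =>
    neg_le_neg (quadratic_le_of_apply_eq hA hpos (hAB _) x)
  have hval : - quadratic A (y + v) (B (y + v)) = 1 / 2 * ⟪B (y + v), y + v⟫_ℝ := by
    rw [quadratic, hAB, real_inner_comm]
    ring
  rw [conjugate]
  simp only [key]
  rw [← hval]
  exact le_antisymm (ciSup_le hmin)
    (le_ciSup (f := fun x => - quadratic A (y + v) x) ⟨_, by rintro _ ⟨x, rfl⟩; exact hmin x⟩ _)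

variable [CompleteSpace H]

theorem hasGradientAt_quadratic {A : H →L[ℝ] H} (hA : ∀ x y, ⟪A x, y⟫_ℝ = ⟪x, A y⟫_ℝ) (v x : H) :
    HasGradientAt (quadratic A v) (A x - v) x := by
  rw [hasGradientAt_iff_hasFDerivAt]
  have h := (((A.hasFDerivAt (x := x)).inner ℝ (hasFDerivAt_id x)).const_mul (1 / 2)).sub
    ((hasFDerivAt_const v x).inner ℝ (hasFDerivAt_id x))
  refine (h.congr_fderiv ?_)
  ext y
  have h1 : ⟪A y, x⟫_ℝ = ⟪A x, y⟫_ℝ := by rw [hA, real_inner_comm]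
  simp [h1]
  ring

theorem gradient_quadratic {A : H →L[ℝ] H} (hA : ∀ x y, ⟪A x, y⟫_ℝ = ⟪x, A y⟫_ℝ) (v x : H) :
    gradient (quadratic A v) x = A x - v :=
  (hasGradientAt_quadratic hA v x).gradient

theorem differentiable_quadratic {A : H →L[ℝ] H} (hA : ∀ x y, ⟪A x, y⟫_ℝ = ⟪x, A y⟫_ℝ) (v : H) :
    Differentiable ℝ (quadratic A v) :=
  fun x => (hasGradientAt_iff_hasFDerivAt.1 (hasGradientAt_quadratic hA v x)).differentiableAt

theorem isSmooth_quadratic {A : H →L[ℝ] H} (hA : ∀ x y, ⟪A x, y⟫_ℝ = ⟪x, A y⟫_ℝ) (v : H) {l : ℝ}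
    (hl : ∀ x, ‖A x‖ ≤ l * ‖x‖) : IsSmooth l (quadratic A v) := by
  refine ⟨differentiable_quadratic hA v, fun x y => ?_⟩
  rw [gradient_quadratic hA, gradient_quadratic hA, sub_sub_sub_cancel_right, ← map_sub]
  exact hl _

theorem isStronglyConvex_quadratic {A : H →L[ℝ] H} (hA : ∀ x y, ⟪A x, y⟫_ℝ = ⟪x, A y⟫_ℝ) (v : H)
    {m : ℝ} (hm : ∀ x, m * ‖x‖ ^ 2 ≤ ⟪A x, x⟫_ℝ) : IsStronglyConvex m (quadratic A v) := by
  refine ⟨differentiable_quadratic hA v, fun x y => ?_⟩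
  rw [gradient_quadratic hA, quadratic_expand hA v x y]
  linarith [hm (y - x)]

/-- The conjugate is again quadratic up to a constant, with the inverse operator; the dual oracle is
thus an explicit affine map. -/
theorem gradient_conjugate_quadratic {A B : H →L[ℝ] H} (hA : ∀ x y, ⟪A x, y⟫_ℝ = ⟪x, A y⟫_ℝ)
    (hpos : ∀ x, 0 ≤ ⟪A x, x⟫_ℝ) (hB : ∀ x y, ⟪B x, y⟫_ℝ = ⟪x, B y⟫_ℝ)
    (hAB : ∀ x, A (B x) = x) (v y : H) :
    gradient (conjugate (quadratic A v)) y = B (y + v) := by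
  have h : conjugate (quadratic A v) =
      fun y => quadratic B (-(B v)) y + 1 / 2 * ⟪B v, v⟫_ℝ := by
    funext y
    have h1 : ⟪B y, v⟫_ℝ = ⟪B v, y⟫_ℝ := by rw [hB, real_inner_comm]
    rw [conjugate_quadratic hA hpos hAB, quadratic]
    simp only [map_add, inner_add_left, inner_add_right, inner_neg_left, h1]
    ring
  have hg : HasGradientAt (fun y => quadratic B (-(B v)) y + 1 / 2 * ⟪B v, v⟫_ℝ)
      (B y - -(B v)) y := by
    have := hasGradientAt_quadratic hB (-(B v)) y
    rw [hasGradientAt_iff_hasFDerivAt] at this ⊢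
    exact this.add_const _
  rw [h, hg.gradient, map_add, sub_neg_eq_add]

end Quadratic

/-! ### Coordinate couplings and truncated sequences in `ℓ₂` -/

section EllTwo

theorem hasSum_sq_ellTwo (x : EllTwo) : HasSum (fun i => (x i) ^ 2) (‖x‖ ^ 2) := by
  have h := lp.hasSum_norm (p := 2) (by norm_num) x
  simpa using h

theorem memℓp_two_of_summable {x : ℕ → ℝ} (h : Summable fun i => (x i) ^ 2) :
    Memℓp (E := fun _ : ℕ => ℝ) x 2 := by
  refine memℓp_gen ?_
  simpa using h

/-- The unitary operator permuting the coordinates. -/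
def permOp (σ : Equiv.Perm ℕ) : EllTwo →L[ℝ] EllTwo :=
  LinearMap.mkContinuous
    { toFun := fun x => ⟨fun i => x (σ i), memℓp_two_of_summable
        ((Equiv.summable_iff σ (f := fun i => (x i) ^ 2)).2 (hasSum_sq_ellTwo x).summable)⟩
      map_add' := fun _ _ => rfl
      map_smul' := fun _ _ => rfl } 1 (by
    intro x
    rw [one_mul, ← sq_le_sq₀ (norm_nonneg _) (norm_nonneg _)]
    refine le_of_eq (HasSum.unique (hasSum_sq_ellTwo _) ?_)
    exact (Equiv.hasSum_iff σ (f := fun i => (x i) ^ 2)).2 (hasSum_sq_ellTwo x))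

@[simp]
theorem permOp_apply (σ : Equiv.Perm ℕ) (x : EllTwo) (i : ℕ) : permOp σ x i = x (σ i) := rfl

theorem norm_permOp (σ : Equiv.Perm ℕ) (x : EllTwo) : ‖permOp σ x‖ = ‖x‖ := by
  rw [← sq_eq_sq₀ (norm_nonneg _) (norm_nonneg _)]
  exact (hasSum_sq_ellTwo _).unique
    ((Equiv.hasSum_iff σ (f := fun i => (x i) ^ 2)).2 (hasSum_sq_ellTwo x))

theorem inner_permOp {σ : Equiv.Perm ℕ} (hσ : ∀ i, σ (σ i) = i) (x y : EllTwo) :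
    ⟪permOp σ x, y⟫_ℝ = ⟪x, permOp σ y⟫_ℝ := by
  have h1 := lp.hasSum_inner (𝕜 := ℝ) (permOp σ x) y
  have h2 := lp.hasSum_inner (𝕜 := ℝ) x (permOp σ y)
  rw [← Equiv.hasSum_iff σ] at h1
  refine h1.unique (h2.congr_fun ?_)
  intro i
  simp [hσ]

theorem inner_permOp_self_le (σ : Equiv.Perm ℕ) (x : EllTwo) :
    ⟪permOp σ x, x⟫_ℝ ≤ ‖x‖ ^ 2 := by
  refine (real_inner_le_norm _ _).trans (le_of_eq ?_)
  rw [norm_permOp, sq]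

/-- The operator `a + b (1 - U)`, with `U` the permutation operator of `σ`. -/
def couplingOp (a b : ℝ) (σ : Equiv.Perm ℕ) : EllTwo →L[ℝ] EllTwo :=
  (a + b) • ContinuousLinearMap.id ℝ EllTwo - b • permOp σ

theorem couplingOp_apply (a b : ℝ) (σ : Equiv.Perm ℕ) (x : EllTwo) :
    couplingOp a b σ x = (a + b) • x - b • permOp σ x := by
  simp [couplingOp]

theorem inner_couplingOp (a b : ℝ) {σ : Equiv.Perm ℕ} (hσ : ∀ i, σ (σ i) = i) (x y : EllTwo) :
    ⟪couplingOp a b σ x, y⟫_ℝ = ⟪x, couplingOp a b σ y⟫_ℝ := by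
  simp only [couplingOp_apply, inner_sub_left, inner_sub_right, real_inner_smul_left,
    real_inner_smul_right, inner_permOp hσ]

theorem le_inner_couplingOp (a : ℝ) {b : ℝ} (hb : 0 ≤ b) (σ : Equiv.Perm ℕ) (x : EllTwo) :
    a * ‖x‖ ^ 2 ≤ ⟪couplingOp a b σ x, x⟫_ℝ := by
  simp only [couplingOp_apply, inner_sub_left, real_inner_smul_left, real_inner_self_eq_norm_sq]
  nlinarith [mul_le_mul_of_nonneg_left (inner_permOp_self_le σ x) hb]

theorem norm_couplingOp_le {a b : ℝ} (ha : 0 ≤ a) (hb : 0 ≤ b) (σ : Equiv.Perm ℕ) (x : EllTwo) :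
    ‖couplingOp a b σ x‖ ≤ (a + 2 * b) * ‖x‖ := by
  rw [couplingOp_apply]
  refine (norm_sub_le _ _).trans (le_of_eq ?_)
  rw [norm_smul, norm_smul, norm_permOp, Real.norm_of_nonneg (by positivity),
    Real.norm_of_nonneg hb]
  ring

/-- Since `U² = 1`, `(1 - U)² = 2 (1 - U)`, so the inverse is a coupling operator for the same `σ`.
This is why the dual oracle opens no more coordinates than the primal one. -/
theorem couplingOp_inverse {a b : ℝ} (ha : 0 < a) (hb : 0 ≤ b) {σ : Equiv.Perm ℕ}
    (hσ : ∀ i, σ (σ i) = i) (x : EllTwo) :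
    couplingOp a b σ (couplingOp (1 / a) (-(b / (a * (a + 2 * b)))) σ x) = x := by
  have h : a + 2 * b ≠ 0 := by positivity
  have ha' := ha.ne'
  ext i
  simp only [couplingOp_apply, lp.coeFn_sub, lp.coeFn_smul, Pi.sub_apply, Pi.smul_apply,
    permOp_apply, smul_eq_mul, hσ]
  field_simp
  ring

/-- The sequences supported on the first `N` coordinates. -/
def firstCoords (N : ℕ) : Submodule ℝ EllTwo where
  carrier := {x | ∀ i, N ≤ i → x i = 0}
  add_mem' := by
    intro x y hx hy i hi
    simp [hx i hi, hy i hi]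
  zero_mem' := by
    intro i _
    simp
  smul_mem' := by
    intro t x hx i hi
    simp [hx i hi]

theorem firstCoords_mono {N M : ℕ} (h : N ≤ M) : firstCoords N ≤ firstCoords M :=
  fun _ hx i hi => hx i (h.trans hi)

theorem couplingOp_mem_firstCoords {a b : ℝ} {σ : Equiv.Perm ℕ} {N : ℕ}
    (hσ : b = 0 ∨ ∀ i, N ≤ i → N ≤ σ i) {x : EllTwo} (hx : x ∈ firstCoords N) :
    couplingOp a b σ x ∈ firstCoords N := by
  intro i hi
  rw [couplingOp_apply, lp.coeFn_sub, lp.coeFn_smul, lp.coeFn_smul, Pi.sub_apply, Pi.smul_apply,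
    Pi.smul_apply, permOp_apply, hx i hi]
  rcases hσ with rfl | hσ
  · simp
  · rw [hx (σ i) (hσ i hi), smul_zero, smul_zero, sub_zero]

/-- The involution exchanging `2 j` and `2 j + 1`. -/
def swapEven : Equiv.Perm ℕ :=
  Function.Involutive.toPerm (fun i => if i % 2 = 0 then i + 1 else i - 1) (by
    intro i
    simp only
    grind)

/-- The involution exchanging `2 j + 1` and `2 j + 2`, and fixing `0`. -/
def swapOdd : Equiv.Perm ℕ :=
  Function.Involutive.toPerm (fun i => if i = 0 then 0 else if i % 2 = 1 then i + 1 else i - 1) (by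
    intro i
    simp only
    grind)

theorem swapEven_apply (i : ℕ) : swapEven i = if i % 2 = 0 then i + 1 else i - 1 := rfl

theorem swapOdd_apply (i : ℕ) :
    swapOdd i = if i = 0 then 0 else if i % 2 = 1 then i + 1 else i - 1 := rfl

theorem swapEven_swapEven (i : ℕ) : swapEven (swapEven i) = i :=
  swapEven.left_inv i

theorem swapOdd_swapOdd (i : ℕ) : swapOdd (swapOdd i) = i :=
  swapOdd.left_inv i

/-- No pair `{2j, 2j+1}` straddles an even `N`, and no pair `{2j+1, 2j+2}` an odd one. -/
theorem le_swapEven {N : ℕ} (hN : N % 2 = 0) (i : ℕ) (hi : N ≤ i) : N ≤ swapEven i := by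
  rw [swapEven_apply]
  split_ifs <;> omega

theorem le_swapOdd {N : ℕ} (hN : N % 2 = 1) (i : ℕ) (hi : N ≤ i) : N ≤ swapOdd i := by
  rw [swapOdd_apply]
  split_ifs <;> omega

/-- The geometric sequence `ρ ^ i`. -/
def geometric (ρ : ℝ) (h0 : 0 ≤ ρ) (h1 : ρ < 1) : EllTwo :=
  ⟨fun i => ρ ^ i, memℓp_two_of_summable (by
    simp_rw [← pow_mul, mul_comm _ 2, pow_mul]
    exact summable_geometric_of_lt_one (sq_nonneg _) (by nlinarith))⟩

theorem geometric_apply {ρ : ℝ} (h0 : 0 ≤ ρ) (h1 : ρ < 1) (i : ℕ) :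
    geometric ρ h0 h1 i = ρ ^ i := rfl

theorem geometric_ne_zero {ρ : ℝ} (h0 : 0 ≤ ρ) (h1 : ρ < 1) : geometric ρ h0 h1 ≠ 0 := by
  intro h
  have := congrArg (fun x : EllTwo => x 0) h
  simp [geometric_apply] at this

/-- A sequence with `N` nonzero coordinates approximates a geometric sequence no better than its
truncation does. -/
theorem dist_geometric_ge {ρ : ℝ} (h0 : 0 ≤ ρ) (h1 : ρ < 1) {N : ℕ} {x : EllTwo}
    (hx : x ∈ firstCoords N) :
    ρ ^ (2 * N) * ‖geometric ρ h0 h1‖ ^ 2 ≤ ‖x - geometric ρ h0 h1‖ ^ 2 := by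
  have hg := hasSum_sq_ellTwo (geometric ρ h0 h1)
  have hd := hasSum_sq_ellTwo (x - geometric ρ h0 h1)
  have h := hd.summable.sum_add_tsum_nat_add N
  rw [hd.tsum_eq] at h
  have htail : ∑' i, ((x - geometric ρ h0 h1 : EllTwo) (i + N)) ^ 2
      = ρ ^ (2 * N) * ‖geometric ρ h0 h1‖ ^ 2 := by
    rw [← hg.tsum_eq, ← tsum_mul_left]
    refine tsum_congr fun i => ?_
    rw [lp.coeFn_sub, Pi.sub_apply, hx (i + N) (by omega), geometric_apply, geometric_apply]
    ring
  rw [htail] at h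
  rw [← h]
  exact le_add_of_nonneg_left (Finset.sum_nonneg fun _ _ => sq_nonneg _)

end EllTwo

/-! ### Laplacian eigenvalues -/

section Spectrum

open Matrix

theorem sum_sq_pos {V : Type*} [Fintype V] {x : V → ℝ} (hx : x ≠ 0) : 0 < x ⬝ᵥ x :=
  lt_of_le_of_ne (Finset.sum_nonneg fun _ _ => mul_self_nonneg _)
    (fun h => hx (dotProduct_self_eq_zero.1 h.symm))

variable {V : Type*} [Fintype V] [DecidableEq V] (G : SimpleGraph V) [DecidableRel G.Adj]

theorem dotProduct_lapMatrix_mulVec (x : V → ℝ) :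
    x ⬝ᵥ (G.lapMatrix ℝ *ᵥ x) = (∑ i, ∑ j, if G.Adj i j then (x i - x j) ^ 2 else 0) / 2 := by
  rw [← SimpleGraph.lapMatrix_toLinearMap₂', Matrix.toLinearMap₂'_apply']

theorem exists_eigenvector_of_mem_spectrum {A : Matrix V V ℝ} {t : ℝ} (ht : t ∈ spectrum ℝ A) :
    ∃ x : V → ℝ, x ≠ 0 ∧ A *ᵥ x = t • x := by
  rw [← Matrix.spectrum_toLin', ← Module.End.hasEigenvalue_iff_mem_spectrum] at ht
  obtain ⟨x, hx⟩ := ht.exists_hasEigenvector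
  exact ⟨x, hx.2, by simpa using hx.apply_eq_smul⟩

theorem mem_spectrum_of_mulVec {A : Matrix V V ℝ} {t : ℝ} {x : V → ℝ} (hx : x ≠ 0)
    (h : A *ᵥ x = t • x) : t ∈ spectrum ℝ A := by
  rw [← Matrix.spectrum_toLin', ← Module.End.hasEigenvalue_iff_mem_spectrum]
  refine Module.End.hasEigenvalue_of_hasEigenvector (x := x) ⟨?_, hx⟩
  rw [Module.End.mem_eigenspace_iff]
  simpa using h

/-- The Rayleigh quotient is bounded through `(a - b)² ≤ 2a² + 2b²`. -/
theorem spectrum_lapMatrix_le {D : ℕ} (hD : ∀ v, G.degree v ≤ D) {t : ℝ}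
    (ht : t ∈ spectrum ℝ (G.lapMatrix ℝ)) : t ≤ 2 * D := by
  obtain ⟨x, hx0, hx⟩ := exists_eigenvector_of_mem_spectrum ht
  have h := dotProduct_lapMatrix_mulVec G x
  rw [hx, dotProduct_smul, smul_eq_mul] at h
  have hdeg : ∀ i, (∑ j, if G.Adj i j then (x i) ^ 2 else 0) ≤ D * (x i) ^ 2 := by
    intro i
    have h1 := SimpleGraph.degree_eq_sum_if_adj G (R := ℝ) i
    have h2 : (∑ j, if G.Adj i j then (x i) ^ 2 else 0) = G.degree i * (x i) ^ 2 := by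
      rw [h1, Finset.sum_mul]
      simp
    rw [h2]
    exact mul_le_mul_of_nonneg_right (by exact_mod_cast hD i) (sq_nonneg _)
  have h3 : (∑ i, ∑ j, if G.Adj i j then (x i - x j) ^ 2 else 0) ≤
      2 * (∑ i, ∑ j, if G.Adj i j then (x i) ^ 2 else 0) +
      2 * (∑ j, ∑ i, if G.Adj j i then (x j) ^ 2 else 0) := by
    conv_rhs => arg 2; rw [Finset.sum_comm]
    rw [Finset.mul_sum, Finset.mul_sum, ← Finset.sum_add_distrib]
    refine Finset.sum_le_sum fun i _ => ?_
    rw [Finset.mul_sum, Finset.mul_sum, ← Finset.sum_add_distrib]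
    refine Finset.sum_le_sum fun j _ => ?_
    by_cases hij : G.Adj i j
    · rw [if_pos hij, if_pos hij, if_pos hij.symm]
      nlinarith [sq_nonneg (x i + x j)]
    · simp [hij, G.adj_comm j i]
  have h4 : (∑ i, ∑ j, if G.Adj i j then (x i) ^ 2 else 0) ≤ D * (x ⬝ᵥ x) := by
    rw [dotProduct, Finset.mul_sum]
    exact Finset.sum_le_sum fun i _ => (hdeg i).trans (le_of_eq (by ring))
  have h5 := sum_sq_pos hx0
  have h6 : t * (x ⬝ᵥ x) ≤ 2 * D * (x ⬝ᵥ x) := by linarith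
  exact le_of_mul_le_mul_right h6 h5

/-- Eigenvectors of nonzero eigenvalues are orthogonal to constants, so the Poincaré inequality
applies to them. -/
theorem le_of_mem_spectrum_lapMatrix {γ : ℝ}
    (hγ : ∀ x : V → ℝ, ∑ v, x v = 0 → γ * (x ⬝ᵥ x) ≤ x ⬝ᵥ (G.lapMatrix ℝ *ᵥ x)) {t : ℝ}
    (ht : t ∈ spectrum ℝ (G.lapMatrix ℝ)) (ht0 : t ≠ 0) : γ ≤ t := by
  obtain ⟨x, hx0, hx⟩ := exists_eigenvector_of_mem_spectrum ht
  have hsum : ∑ v, x v = 0 := by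
    have h1 : (fun _ => (1 : ℝ)) ⬝ᵥ (G.lapMatrix ℝ *ᵥ x) = 0 := by
      rw [dotProduct_mulVec, ← mulVec_transpose, (G.isSymm_lapMatrix ℝ).eq,
        SimpleGraph.lapMatrix_mulVec_const_eq_zero, zero_dotProduct]
    rw [hx, dotProduct_smul, smul_eq_mul] at h1
    simpa [dotProduct] using (mul_eq_zero.1 h1).resolve_left ht0
  have h := hγ x hsum
  rw [hx, dotProduct_smul, smul_eq_mul] at h
  exact le_of_mul_le_mul_right h (sum_sq_pos hx0)

theorem bddAbove_spectrum_lapMatrix : BddAbove (spectrum ℝ (G.lapMatrix ℝ)) :=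
  ⟨2 * (G.maxDegree : ℕ), fun _ ht => spectrum_lapMatrix_le G (fun v => G.degree_le_maxDegree v) ht⟩

theorem nonneg_of_mem_spectrum_lapMatrix {t : ℝ} (ht : t ∈ spectrum ℝ (G.lapMatrix ℝ)) : 0 ≤ t :=
  (Matrix.posSemidef_iff_isHermitian_and_spectrum_nonneg.1 (G.posSemidef_lapMatrix ℝ)).2 ht

/-- The matrix `s - 𝓛`, where `𝓛` is the Laplacian, is positive semidefinite, so its diagonal
entries `s - deg v` are nonnegative. -/
theorem degree_le_sSup_spectrum (v : V) : (G.degree v : ℝ) ≤ sSup (spectrum ℝ (G.lapMatrix ℝ)) := by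
  set s := sSup (spectrum ℝ (G.lapMatrix ℝ)) with hs
  have hpsd : (algebraMap ℝ (Matrix V V ℝ) s - G.lapMatrix ℝ).PosSemidef := by
    rw [Matrix.posSemidef_iff_isHermitian_and_spectrum_nonneg]
    refine ⟨?_, ?_⟩
    · refine Matrix.IsHermitian.sub ?_ (G.isHermitian_lapMatrix ℝ)
      rw [Matrix.algebraMap_eq_diagonal]
      exact Matrix.isHermitian_diagonal _
    · intro t ht
      rw [← spectrum.singleton_sub_eq, Set.singleton_sub] at ht
      obtain ⟨u, hu, rfl⟩ := ht
      exact sub_nonneg.2 (le_csSup (bddAbove_spectrum_lapMatrix G) hu)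
  have h := hpsd.diag_nonneg (i := v)
  rw [Matrix.sub_apply, Matrix.algebraMap_eq_diagonal] at h
  simpa [SimpleGraph.lapMatrix, SimpleGraph.degMatrix] using h

theorem le_matrixCond_lapMatrix (h1 : (1 : ℝ) ∈ spectrum ℝ (G.lapMatrix ℝ)) {γ : ℝ} (hγ0 : 0 < γ)
    (hγ : ∀ x : V → ℝ, ∑ v, x v = 0 → γ * (x ⬝ᵥ x) ≤ x ⬝ᵥ (G.lapMatrix ℝ *ᵥ x)) (v : V) :
    (G.degree v : ℝ) ≤ matrixCond (G.lapMatrix ℝ) := by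
  have hmem : (1 : ℝ) ∈ {t : ℝ | t ∈ spectrum ℝ (G.lapMatrix ℝ) ∧ t ≠ 0} := ⟨h1, one_ne_zero⟩
  have hlow : γ ≤ sInf {t : ℝ | t ∈ spectrum ℝ (G.lapMatrix ℝ) ∧ t ≠ 0} :=
    le_csInf ⟨1, hmem⟩ fun t ht => le_of_mem_spectrum_lapMatrix G hγ ht.1 ht.2
  have hup : sInf {t : ℝ | t ∈ spectrum ℝ (G.lapMatrix ℝ) ∧ t ≠ 0} ≤ 1 :=
    csInf_le ⟨0, fun t ht => nonneg_of_mem_spectrum_lapMatrix G ht.1⟩ hmem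
  rw [matrixCond, le_div_iff₀ (hγ0.trans_le hlow)]
  calc (G.degree v : ℝ) * _ ≤ G.degree v * 1 :=
        mul_le_mul_of_nonneg_left hup (Nat.cast_nonneg _)
    _ ≤ _ := by rw [mul_one]; exact degree_le_sSup_spectrum G v

theorem matrixCond_lapMatrix_le (h1 : (1 : ℝ) ∈ spectrum ℝ (G.lapMatrix ℝ)) {D : ℕ}
    (hD : ∀ v, G.degree v ≤ D) {γ : ℝ} (hγ0 : 0 < γ)
    (hγ : ∀ x : V → ℝ, ∑ v, x v = 0 → γ * (x ⬝ᵥ x) ≤ x ⬝ᵥ (G.lapMatrix ℝ *ᵥ x)) :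
    matrixCond (G.lapMatrix ℝ) ≤ 2 * D / γ := by
  have hmem : (1 : ℝ) ∈ {t : ℝ | t ∈ spectrum ℝ (G.lapMatrix ℝ) ∧ t ≠ 0} := ⟨h1, one_ne_zero⟩
  have hlow : γ ≤ sInf {t : ℝ | t ∈ spectrum ℝ (G.lapMatrix ℝ) ∧ t ≠ 0} :=
    le_csInf ⟨1, hmem⟩ fun t ht => le_of_mem_spectrum_lapMatrix G hγ ht.1 ht.2
  exact div_le_div₀ (by positivity) (csSup_le ⟨1, h1⟩ fun t ht => spectrum_lapMatrix_le G hD ht)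
    hγ0 hlow

end Spectrum

open Classical in
theorem graphCond_comap {n : ℕ} (G : SimpleGraph (Fin n)) (π : Equiv.Perm (Fin n)) :
    graphCond (G.comap π) = graphCond G := by
  have h : G.lapMatrix ℝ = Matrix.reindexAlgEquiv ℝ ℝ π ((G.comap π).lapMatrix ℝ) := by
    let φ : G.comap π ≃g G := ⟨π, Iff.rfl⟩
    ext i j
    simp only [Matrix.coe_reindexAlgEquiv, Matrix.reindex_apply, Matrix.submatrix_apply,
      SimpleGraph.lapMatrix, Matrix.sub_apply, SimpleGraph.degMatrix, Matrix.diagonal_apply,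
      SimpleGraph.adjMatrix_apply, SimpleGraph.comap_adj, Equiv.apply_symm_apply,
      EmbeddingLike.apply_eq_iff_eq]
    have hd := φ.degree_eq (π.symm i)
    have hi : φ (π.symm i) = i := π.apply_symm_apply i
    rw [hi] at hd
    rw [hd]
  rw [graphCond, graphCond, matrixCond, matrixCond, h, AlgEquiv.spectrum_eq]
  congr!

/-! ### The tree of base-`k` expansions -/

/-- `v` with its last `i` digits in base `k` replaced by zeros. -/
def truncate (k i v : ℕ) : ℕ := v / k ^ i * k ^ i

theorem truncate_le (k i v : ℕ) : truncate k i v ≤ v := Nat.div_mul_le_self v _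

theorem truncate_zero (k v : ℕ) : truncate k 0 v = v := by simp [truncate]

theorem truncate_eq_zero {k i v : ℕ} (h : v < k ^ i) : truncate k i v = 0 := by
  simp [truncate, Nat.div_eq_of_lt h]

theorem dvd_truncate (k i v : ℕ) : k ^ i ∣ truncate k i v := Dvd.intro_left _ rfl

theorem lt_truncate_add {k : ℕ} (hk : 0 < k) (i v : ℕ) : v < truncate k i v + k ^ i := by
  have h := Nat.lt_mul_div_succ v (pow_pos hk i)
  rw [truncate]
  linarith

theorem truncate_eq {k i u v : ℕ} (hu : k ^ i ∣ u) (h1 : u ≤ v) (h2 : v < u + k ^ i) :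
    truncate k i v = u := by
  obtain ⟨c, rfl⟩ := hu
  have : v / k ^ i = c := Nat.div_eq_of_lt_le (by linarith) (by linarith)
  rw [truncate, this, mul_comm]

theorem truncate_succ_truncate {k : ℕ} (hk : 0 < k) (i v : ℕ) :
    truncate k (i + 1) (truncate k i v) = truncate k (i + 1) v := by
  have h1 := truncate_le k i v
  have h2 := lt_truncate_add hk (i + 1) v
  refine truncate_eq (dvd_truncate _ _ _) ?_ (by omega)
  have h3 : k ^ i ∣ truncate k (i + 1) v := (pow_dvd_pow k (Nat.le_succ i)).trans (dvd_truncate _ _ _)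
  obtain ⟨c, hc⟩ := h3
  rw [hc, truncate, mul_comm]
  refine Nat.mul_le_mul_right _ ((Nat.le_div_iff_mul_le (pow_pos hk i)).2 ?_)
  rw [mul_comm, ← hc]
  exact truncate_le _ _ _

/-- `u` arises from `v` by deleting the last nonzero digit in base `k`. -/
def IsParent (k d u v : ℕ) : Prop :=
  ∃ i < d, k ^ (i + 1) ∣ u ∧ u < v ∧ v < u + k ^ (i + 1) ∧ k ^ i ∣ v

theorem isParent_truncate {k d i v : ℕ} (hk : 0 < k) (hi : i < d) (hv : k ^ i ∣ v)
    (h : truncate k (i + 1) v ≠ v) : IsParent k d (truncate k (i + 1) v) v :=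
  ⟨i, hi, dvd_truncate _ _ _, lt_of_le_of_ne (truncate_le _ _ _) h, lt_truncate_add hk _ _, hv⟩

/-- The tree on `{0, …, k ^ d - 1}` in which the parent of a number is obtained by deleting its last
nonzero digit in base `k`. -/
def digitTree (k d : ℕ) : SimpleGraph (Fin (k ^ d)) where
  Adj u v := IsParent k d u v ∨ IsParent k d v u
  symm := ⟨fun _ _ h => h.symm⟩
  loopless := ⟨fun v h => by
    rcases h with ⟨i, _, _, h, _⟩ | ⟨i, _, _, h, _⟩ <;> exact lt_irrefl _ h⟩

theorem digitTree_adj {k d : ℕ} {u v : Fin (k ^ d)} :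
    (digitTree k d).Adj u v ↔ IsParent k d u v ∨ IsParent k d v u := Iff.rfl

/-- `truncate` as a map of `Fin (k ^ d)` to itself. -/
def finTruncate (k d i : ℕ) (v : Fin (k ^ d)) : Fin (k ^ d) :=
  ⟨truncate k i v, (truncate_le _ _ _).trans_lt v.2⟩

theorem exists_isParent {k d v : ℕ} (hk : 0 < k) (hv0 : v ≠ 0) (hv : v < k ^ d) :
    ∃ u, IsParent k d u v := by
  by_contra hcon
  -- If `v` had no parent, every truncation would fix it; divisibility by `k ^ i` would climb up to
  -- `k ^ d > v`.
  have h : ∀ i ≤ d, k ^ i ∣ v := by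
    intro i
    induction i with
    | zero => simp
    | succ i ih =>
      intro hi
      by_contra hdvd
      refine hcon ⟨_, isParent_truncate hk hi (ih (by omega)) fun h => hdvd ?_⟩
      rw [← h]
      exact dvd_truncate _ _ _
  exact hv0 (Nat.eq_zero_of_dvd_of_lt (h d le_rfl) hv)

theorem digitTree_connected {k d : ℕ} (hk : 0 < k) : (digitTree k d).Connected := by
  have hpos : 0 < k ^ d := pow_pos hk d
  have key : ∀ m (hm : m < k ^ d), (digitTree k d).Reachable ⟨m, hm⟩ ⟨0, hpos⟩ := by
    intro m
    induction m using Nat.strong_induction_on with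
    | _ m ih =>
      intro hm
      rcases Nat.eq_zero_or_pos m with rfl | h0
      · exact SimpleGraph.Reachable.refl _
      · obtain ⟨u, hu⟩ := exists_isParent hk h0.ne' hm
        have hlt : u < m := by
          obtain ⟨_, _, _, h, _⟩ := hu
          exact h
        have hadj : (digitTree k d).Adj ⟨m, hm⟩ ⟨u, hlt.trans hm⟩ := Or.inr hu
        exact hadj.reachable.trans (ih u hlt _)
  have : Nonempty (Fin (k ^ d)) := ⟨⟨0, hpos⟩⟩
  exact SimpleGraph.Connected.mk fun u v => (key u u.2).trans (key v v.2).symm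

section Degree

open Classical in
theorem digitTree_degree_le {k d : ℕ} (v : Fin (k ^ d)) :
    (digitTree k d).degree v ≤ d * k + d := by
  have hsub : ((digitTree k d).neighborFinset v).map Fin.valEmbedding ⊆
      (Finset.range d ×ˢ Finset.range k).image (fun p => (v : ℕ) + p.2 * k ^ p.1) ∪
      (Finset.range d).image (fun i => truncate k (i + 1) v) := by
    intro w hw
    rw [Finset.mem_map] at hw
    obtain ⟨w, hw, rfl⟩ := hw
    rw [SimpleGraph.mem_neighborFinset, digitTree_adj] at hw
    rw [Finset.mem_union, Finset.mem_image, Finset.mem_image]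
    rcases hw with ⟨i, hi, h1, h2, h3, h4⟩ | ⟨i, hi, h1, h2, h3, h4⟩
    · left
      have h5 : k ^ i ∣ (w : ℕ) - v :=
        Nat.dvd_sub h4 ((pow_dvd_pow k (Nat.le_succ i)).trans h1)
      obtain ⟨c, hc⟩ := h5
      refine ⟨(i, c), ?_, ?_⟩
      · rw [Finset.mem_product, Finset.mem_range, Finset.mem_range]
        refine ⟨hi, ?_⟩
        have : k ^ i * c < k ^ i * k := by rw [← hc, ← pow_succ]; omega
        exact lt_of_mul_lt_mul_left this (Nat.zero_le _)
      · change (v : ℕ) + c * k ^ i = w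
        rw [mul_comm, ← hc]
        omega
    · right
      exact ⟨i, Finset.mem_range.2 hi, truncate_eq h1 h2.le h3⟩
  calc (digitTree k d).degree v = (((digitTree k d).neighborFinset v).map Fin.valEmbedding).card := by
        rw [Finset.card_map, SimpleGraph.card_neighborFinset_eq_degree]
    _ ≤ _ := Finset.card_le_card hsub
    _ ≤ _ := Finset.card_union_le _ _
    _ ≤ d * k + d := by
      refine add_le_add (Finset.card_image_le.trans ?_) (Finset.card_image_le.trans ?_) <;> simp

open Classical in
theorem le_digitTree_degree_zero {k d : ℕ} (hk : 0 < k) (hd : 0 < d) :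
    k - 1 ≤ (digitTree k d).degree ⟨0, pow_pos hk d⟩ := by
  have hkd : k ≤ k ^ d := Nat.le_self_pow hd.ne' k
  have hsub : (Finset.Ico 1 k) ⊆
      ((digitTree k d).neighborFinset ⟨0, pow_pos hk d⟩).map Fin.valEmbedding := by
    intro w hw
    rw [Finset.mem_Ico] at hw
    rw [Finset.mem_map]
    refine ⟨⟨w, by omega⟩, ?_, rfl⟩
    rw [SimpleGraph.mem_neighborFinset, digitTree_adj]
    exact Or.inl ⟨0, hd, dvd_zero _, hw.1, by simpa using hw.2, by simp⟩
  have := Finset.card_le_card hsub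
  rwa [Nat.card_Ico, Finset.card_map, SimpleGraph.card_neighborFinset_eq_degree] at this

end Degree

/-! ### Spectral bounds for the tree -/

section Poincare

open Matrix

/-- A fibre of the truncation lies in an interval of `k ^ i` consecutive numbers. -/
theorem sum_finTruncate_le {k d i : ℕ} (hk : 0 < k) {g : Fin (k ^ d) → ℝ} (hg : ∀ v, 0 ≤ g v) :
    ∑ v, g (finTruncate k d i v) ≤ (k : ℝ) ^ i * ∑ v, g v := by
  classical
  rw [← Finset.sum_fiberwise (s := Finset.univ) (g := finTruncate k d i), Finset.mul_sum]
  refine Finset.sum_le_sum fun w _ => ?_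
  have h1 : ∑ v with finTruncate k d i v = w, g (finTruncate k d i v) =
      ((Finset.univ.filter fun v => finTruncate k d i v = w).card : ℝ) * g w := by
    rw [Finset.sum_congr rfl (g := fun _ => g w), Finset.sum_const, nsmul_eq_mul]
    intro v hv
    rw [(Finset.mem_filter.1 hv).2]
  rw [h1]
  refine mul_le_mul_of_nonneg_right ?_ (hg w)
  have hsub : (Finset.univ.filter fun v => finTruncate k d i v = w).map Fin.valEmbedding ⊆
      Finset.Ico (w : ℕ) (w + k ^ i) := by
    intro v hv
    rw [Finset.mem_map] at hv
    obtain ⟨v, hv, rfl⟩ := hv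
    have hv' := congrArg Fin.val (Finset.mem_filter.1 hv).2
    change truncate k i v = w at hv'
    rw [Finset.mem_Ico, ← hv']
    exact ⟨truncate_le _ _ _, lt_truncate_add hk _ _⟩
  have hcard := Finset.card_le_card hsub
  rw [Finset.card_map, Nat.card_Ico, Nat.add_sub_cancel_left] at hcard
  exact_mod_cast hcard

-- Differences to the root are telescoped along the path of truncations, and `sum_finTruncate_le`
-- counts how often an edge is used. The factor 2 arises because `∑ g` counts each edge from both
-- ends.
open Classical in
theorem digitTree_poincare {k d : ℕ} (hk : 0 < k) (hd : 0 < d) (x : Fin (k ^ d) → ℝ)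
    (hx : ∑ v, x v = 0) :
    1 / (2 * d ^ 2 * (k : ℝ) ^ (d - 1)) * (x ⬝ᵥ x) ≤
      x ⬝ᵥ ((digitTree k d).lapMatrix ℝ *ᵥ x) := by
  have hpos : 0 < k ^ d := pow_pos hk d
  set o : Fin (k ^ d) := ⟨0, hpos⟩ with ho
  set g : Fin (k ^ d) → ℝ :=
    fun i => ∑ j, if (digitTree k d).Adj i j then (x i - x j) ^ 2 else 0 with hg
  have hg0 : ∀ v, 0 ≤ g v := fun v => Finset.sum_nonneg fun j _ => by positivity
  rw [dotProduct_lapMatrix_mulVec]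
  have hstep : ∀ i < d, ∀ v,
      (x (finTruncate k d i v) - x (finTruncate k d (i + 1) v)) ^ 2 ≤ g (finTruncate k d i v) := by
    intro i hi v
    by_cases h : finTruncate k d (i + 1) v = finTruncate k d i v
    · rw [h, sub_self]
      simpa using hg0 _
    · have hadj : (digitTree k d).Adj (finTruncate k d i v) (finTruncate k d (i + 1) v) := by
        right
        have h1 := truncate_succ_truncate hk i v
        have h2 := isParent_truncate (d := d) hk hi (dvd_truncate k i v) (by
          rw [h1]
          exact fun h' => h (Fin.ext h'))
        rw [h1] at h2
        exact h2
      have := Finset.single_le_sum (f := fun j => if (digitTree k d).Adj (finTruncate k d i v) j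
        then (x (finTruncate k d i v) - x j) ^ 2 else 0) (fun j _ => by positivity)
        (Finset.mem_univ (finTruncate k d (i + 1) v))
      simpa [hadj] using this
  have hv : ∀ v, (x v - x o) ^ 2 ≤ d * ∑ i ∈ Finset.range d, g (finTruncate k d i v) := by
    intro v
    have htel := Finset.sum_range_sub' (fun i => x (finTruncate k d i v)) d
    have h0 : finTruncate k d 0 v = v := Fin.ext (truncate_zero k v)
    have hdd : finTruncate k d d v = o := Fin.ext (truncate_eq_zero v.2)
    rw [h0, hdd] at htel
    rw [← htel]
    have h := sq_sum_le_card_mul_sum_sq (s := Finset.range d)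
      (f := fun i => x (finTruncate k d i v) - x (finTruncate k d (i + 1) v))
    rw [Finset.card_range] at h
    refine h.trans (mul_le_mul_of_nonneg_left ?_ (Nat.cast_nonneg _))
    exact Finset.sum_le_sum fun i hi => hstep i (Finset.mem_range.1 hi) v
  -- For a zero-sum `x` the mean is the best constant approximation, so replacing it by `x o` only
  -- increases the sum.
  have hsumle : x ⬝ᵥ x ≤ ∑ v, (x v - x o) ^ 2 := by
    have : ∑ v, (x v - x o) ^ 2 = x ⬝ᵥ x - 2 * x o * ∑ v, x v + ∑ _v : Fin (k ^ d), (x o) ^ 2 := by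
      rw [dotProduct, Finset.mul_sum, ← Finset.sum_sub_distrib, ← Finset.sum_add_distrib]
      exact Finset.sum_congr rfl fun v _ => by ring
    rw [this, hx]
    have : 0 ≤ ∑ _v : Fin (k ^ d), (x o) ^ 2 := Finset.sum_nonneg fun _ _ => sq_nonneg _
    linarith
  have hk1 : (1 : ℝ) ≤ k := by exact_mod_cast hk
  have htot : ∑ v, (x v - x o) ^ 2 ≤ d * (d * ((k : ℝ) ^ (d - 1) * ∑ v, g v)) := by
    refine (Finset.sum_le_sum fun v _ => hv v).trans ?_
    rw [← Finset.mul_sum, Finset.sum_comm]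
    refine mul_le_mul_of_nonneg_left ?_ (Nat.cast_nonneg _)
    have : ∑ i ∈ Finset.range d, ∑ v, g (finTruncate k d i v) ≤
        ∑ _i ∈ Finset.range d, (k : ℝ) ^ (d - 1) * ∑ v, g v := by
      refine Finset.sum_le_sum fun i hi => (sum_finTruncate_le hk hg0).trans ?_
      refine mul_le_mul_of_nonneg_right ?_ (Finset.sum_nonneg fun v _ => hg0 v)
      have := Finset.mem_range.1 hi
      exact pow_le_pow_right₀ hk1 (by omega)
    simpa using this
  have hd' : (0 : ℝ) < d := by exact_mod_cast hd
  have hc : 0 < 2 * (d : ℝ) ^ 2 * (k : ℝ) ^ (d - 1) := by positivity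
  rw [div_mul_eq_mul_div, one_mul, div_le_iff₀ hc]
  refine (hsumle.trans htot).trans (le_of_eq ?_)
  ring

/-- The vertices 1 and 2 are leaves attached to the root; the difference of their indicators is an
eigenvector. -/
theorem one_mem_spectrum_digitTree [∀ k d, DecidableRel (digitTree k d).Adj] {k d : ℕ} (hk : 3 ≤ k)
    (hd : 0 < d) : (1 : ℝ) ∈ spectrum ℝ ((digitTree k d).lapMatrix ℝ) := by
  classical
  have hkd : k ≤ k ^ d := Nat.le_self_pow hd.ne' k
  have hleaf : ∀ m, 0 < m → m < k → ∀ w : ℕ, (IsParent k d m w ∨ IsParent k d w m) ↔ w = 0 := by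
    intro m hm0 hmk w
    constructor
    · rintro (⟨i, hi, h1, -⟩ | ⟨i, hi, h1, h2, -⟩)
      · have := Nat.le_of_dvd hm0 h1
        have h3 : k ≤ k ^ (i + 1) := Nat.le_self_pow (by omega) k
        omega
      · by_contra hw
        have := Nat.le_of_dvd (Nat.pos_of_ne_zero hw) h1
        have h3 : k ≤ k ^ (i + 1) := Nat.le_self_pow (by omega) k
        omega
    · rintro rfl
      exact Or.inr ⟨0, hd, dvd_zero _, hm0, by simpa using hmk, by simp⟩
  set a : Fin (k ^ d) := ⟨1, by omega⟩ with ha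
  set b : Fin (k ^ d) := ⟨2, by omega⟩ with hb
  have hab : a ≠ b := by simp [ha, hb]
  have hadj : ∀ w, (digitTree k d).Adj w a ↔ (digitTree k d).Adj w b := by
    intro w
    rw [SimpleGraph.adj_comm, SimpleGraph.adj_comm _ w b, digitTree_adj, digitTree_adj]
    exact (hleaf 1 (by omega) (by omega) w).trans (hleaf 2 (by omega) (by omega) w).symm
  have hdeg : ∀ m (hm : m < k), 0 < m →
      (digitTree k d).degree ⟨m, by omega⟩ = 1 := by
    intro m hm hm0
    rw [← SimpleGraph.card_neighborFinset_eq_degree, Finset.card_eq_one]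
    refine ⟨⟨0, by omega⟩, ?_⟩
    ext w
    rw [SimpleGraph.mem_neighborFinset, digitTree_adj, Finset.mem_singleton, Fin.ext_iff]
    exact hleaf m hm0 hm w
  refine mem_spectrum_of_mulVec (x := Pi.single a 1 - Pi.single b 1) ?_ ?_
  · intro h
    have := congrFun h a
    simp [hab] at this
  · have hdega : (digitTree k d).degree a = 1 := hdeg 1 (by omega) (by omega)
    have hdegb : (digitTree k d).degree b = 1 := hdeg 2 (by omega) (by omega)
    ext w
    rw [SimpleGraph.lapMatrix_mulVec_apply]
    have hsum : ∑ u ∈ (digitTree k d).neighborFinset w,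
        ((Pi.single a 1 - Pi.single b 1 : Fin (k ^ d) → ℝ) u) = 0 := by
      by_cases h : (digitTree k d).Adj w b <;> simp [Finset.sum_sub_distrib, h, hadj]
    rw [hsum, sub_zero, one_smul]
    by_cases hwa : w = a
    · rw [hwa, hdega]
      simp
    by_cases hwb : w = b
    · rw [hwb, hdegb]
      simp
    simp [hwa, hwb]

end Poincare

theorem le_graphCond_digitTree {k d : ℕ} (hk : 3 ≤ k) (hd : 0 < d) :
    ((k - 1 : ℕ) : ℝ) ≤ graphCond (digitTree k d) := by
  classical
  have hk0 : 0 < k := by omega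
  have hk' : (0 : ℝ) < k := by exact_mod_cast hk0
  have hd' : (0 : ℝ) < d := by exact_mod_cast hd
  refine le_trans ?_ (le_matrixCond_lapMatrix (digitTree k d) (one_mem_spectrum_digitTree hk hd)
    (by positivity) (digitTree_poincare hk0 hd) ⟨0, pow_pos hk0 d⟩)
  exact_mod_cast le_digitTree_degree_zero hk0 hd

theorem graphCond_digitTree_le {k d : ℕ} (hk : 3 ≤ k) (hd : 0 < d) :
    graphCond (digitTree k d) ≤ 8 * d ^ 3 * ((k ^ d : ℕ) : ℝ) := by
  classical
  have hk0 : 0 < k := by omega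
  have hk' : (0 : ℝ) < k := by exact_mod_cast hk0
  have hk1 : (1 : ℝ) ≤ k := by exact_mod_cast hk0
  have hd' : (0 : ℝ) < d := by exact_mod_cast hd
  refine (matrixCond_lapMatrix_le (digitTree k d) (one_mem_spectrum_digitTree hk hd)
    (digitTree_degree_le) (by positivity) (digitTree_poincare hk0 hd)).trans ?_
  obtain ⟨e, rfl⟩ : ∃ e, d = e + 1 := ⟨d - 1, by omega⟩
  rw [div_div_eq_mul_div, div_one, Nat.add_sub_cancel]
  set D : ℝ := ((e + 1 : ℕ) : ℝ) with hD
  have h1 : ((((e + 1) * k + (e + 1) : ℕ)) : ℝ) ≤ 2 * D * k := by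
    push_cast [hD] at hd' ⊢
    nlinarith
  calc 2 * ((((e + 1) * k + (e + 1) : ℕ)) : ℝ) * (2 * D ^ 2 * (k : ℝ) ^ e)
      ≤ 2 * (2 * D * k) * (2 * D ^ 2 * (k : ℝ) ^ e) := by gcongr
    _ = _ := by push_cast; ring

/-! ### Boundary of an interval in the tree, and its relocation -/

/-- The neighbours of an interval whose upper end is a multiple of `k ^ (d - 1)` are truncations of
its lower end. -/
theorem exists_eq_truncate_of_adj {k d j e : ℕ} (hj : 0 < j)
    (he : k ^ (d - 1) ∣ e) {v w : Fin (k ^ d)} (hadj : (digitTree k d).Adj v w)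
    (hv1 : j ≤ v) (hv2 : (v : ℕ) < e) (hw : ¬ (j ≤ (w : ℕ) ∧ (w : ℕ) < e)) :
    (w : ℕ) < j ∧ ∃ i < d, (w : ℕ) = truncate k (i + 1) j := by
  rcases hadj with ⟨i, hi, h1, h2, h3, h4⟩ | ⟨i, hi, h1, h2, h3, h4⟩
  · exfalso
    -- If `v` is the parent, all its children by the digit `i` lie below the next multiple of `k ^
    -- (i + 1)`, hence below `e`; the case `i + 1 = d` would make `v` the root.
    rcases Nat.lt_or_ge (i + 1) d with h | h
    · have h5 : k ^ (i + 1) ∣ e - v :=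
        Nat.dvd_sub ((pow_dvd_pow k (by omega)).trans he) h1
      have := Nat.le_of_dvd (by omega) h5
      omega
    · have hid : i + 1 = d := by omega
      rw [hid] at h1
      have := Nat.eq_zero_of_dvd_of_lt h1 v.2
      omega
  · have hwj : (w : ℕ) < j := by omega
    exact ⟨hwj, i, hi, (truncate_eq h1 hwj.le (by omega)).symm⟩

theorem exists_perm_mapsTo {β : Type*} [DecidableEq β] {A B : Finset β} (h : A.card ≤ B.card) :
    ∃ τ : Equiv.Perm β, (∀ a ∈ A, τ a ∈ B) ∧ ∀ x, x ∉ A ∪ B → τ x = x := by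
  obtain ⟨B', hB', hcard⟩ := Finset.exists_subset_card_eq h
  let p : {x // x ∈ A ∪ B} → Prop := fun x => x.1 ∈ A
  let q : {x // x ∈ A ∪ B} → Prop := fun x => x.1 ∈ B'
  have e1 : {x // p x} ≃ A :=
    ⟨fun x => ⟨x.1.1, x.2⟩, fun x => ⟨⟨x.1, Finset.mem_union_left _ x.2⟩, x.2⟩,
      fun _ => rfl, fun _ => rfl⟩
  have e2 : {x // q x} ≃ B' :=
    ⟨fun x => ⟨x.1.1, x.2⟩, fun x => ⟨⟨x.1, Finset.mem_union_right _ (hB' x.2)⟩, x.2⟩,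
      fun _ => rfl, fun _ => rfl⟩
  have e : {x // p x} ≃ {x // q x} :=
    (e1.trans (Finset.equivOfCardEq hcard.symm)).trans e2.symm
  refine ⟨Equiv.Perm.ofSubtype e.extendSubtype, fun a ha => ?_, fun x hx => ?_⟩
  · have ha' : a ∈ A ∪ B := Finset.mem_union_left _ ha
    rw [Equiv.Perm.ofSubtype_apply_of_mem _ ha']
    exact hB' (e.extendSubtype_mem ⟨a, ha'⟩ ha)
  · exact Equiv.Perm.ofSubtype_apply_of_not_mem _ hx

-- Every changed edge is incident to a vertex of `W`.
open Classical in
theorem ncard_symmDiff_edgeSet_le {V : Type*} [Fintype V] (G G' : SimpleGraph V) (W : Finset V)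
    {D : ℕ} (hG : ∀ v, G.degree v ≤ D) (hG' : ∀ v, G'.degree v ≤ D)
    (hW : ∀ u v, u ∉ W → v ∉ W → (G.Adj u v ↔ G'.Adj u v)) :
    (symmDiff G.edgeSet G'.edgeSet).ncard ≤ W.card * (2 * D) := by
  have hsub : symmDiff G.edgeSet G'.edgeSet ⊆
      ((W.biUnion fun u => G.incidenceFinset u ∪ G'.incidenceFinset u : Finset (Sym2 V)) :
        Set (Sym2 V)) := by
    intro e
    induction e using Sym2.ind with
    | _ u v =>
      intro h
      have hne : ¬ (G.Adj u v ↔ G'.Adj u v) := by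
        rw [Set.mem_symmDiff, SimpleGraph.mem_edgeSet, SimpleGraph.mem_edgeSet] at h
        tauto
      have hor : G.Adj u v ∨ G'.Adj u v := by tauto
      have hmem : u ∈ W ∨ v ∈ W := by
        by_contra hcon
        push Not at hcon
        exact hne (hW u v hcon.1 hcon.2)
      rw [Finset.mem_coe, Finset.mem_biUnion]
      rcases hmem with hu | hv
      · refine ⟨u, hu, ?_⟩
        simpa [SimpleGraph.mem_incidenceFinset, SimpleGraph.mk'_mem_incidenceSet_iff] using hor
      · refine ⟨v, hv, ?_⟩
        simpa [SimpleGraph.mem_incidenceFinset, SimpleGraph.mk'_mem_incidenceSet_iff] using hor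
  refine (Set.ncard_le_ncard hsub (Finset.finite_toSet _)).trans ?_
  rw [Set.ncard_coe_finset]
  refine Finset.card_biUnion_le_card_mul _ _ _ fun u _ => ?_
  refine (Finset.card_union_le _ _).trans ?_
  rw [SimpleGraph.card_incidenceFinset_eq_degree, SimpleGraph.card_incidenceFinset_eq_degree]
  linarith [hG u, hG' u]

/-- The truncations of `j` that are smaller than `j`. -/
def truncations (k d j : ℕ) : Finset (Fin (k ^ d)) :=
  Finset.univ.filter fun v => (v : ℕ) < j ∧ ∃ i < d, (v : ℕ) = truncate k (i + 1) j

/-- The elements of `[j - d, j)`. -/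
def window (k d j : ℕ) : Finset (Fin (k ^ d)) :=
  Finset.univ.filter fun v => j - d ≤ (v : ℕ) ∧ (v : ℕ) < j

theorem card_truncations_le (k d j : ℕ) : (truncations k d j).card ≤ d := by
  have hsub : (truncations k d j).map Fin.valEmbedding ⊆
      (Finset.range d).image fun i => truncate k (i + 1) j := by
    intro w hw
    rw [Finset.mem_map] at hw
    obtain ⟨w, hw, rfl⟩ := hw
    obtain ⟨-, i, hi, h⟩ := (Finset.mem_filter.1 hw).2
    exact Finset.mem_image.2 ⟨i, Finset.mem_range.2 hi, h.symm⟩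
  have := (Finset.card_le_card hsub).trans Finset.card_image_le
  rwa [Finset.card_map, Finset.card_range] at this

theorem card_window {k d j : ℕ} (h1 : d ≤ j) (h2 : j ≤ k ^ d) : (window k d j).card = d := by
  have : (window k d j).map Fin.valEmbedding = Finset.Ico (j - d) j := by
    ext w
    rw [Finset.mem_map, Finset.mem_Ico]
    constructor
    · rintro ⟨w, hw, rfl⟩
      exact (Finset.mem_filter.1 hw).2
    · intro hw
      exact ⟨⟨w, by omega⟩, Finset.mem_filter.2 ⟨Finset.mem_univ _, hw⟩, rfl⟩
  rw [← Finset.card_map Fin.valEmbedding, this, Nat.card_Ico]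
  omega

open Classical in
/-- A permutation moving the truncations of `j` into the window below `j`. -/
def shiftPerm (k d j : ℕ) : Equiv.Perm (Fin (k ^ d)) :=
  if h : (truncations k d j).card ≤ (window k d j).card then
    Classical.choose (exists_perm_mapsTo h) else 1

theorem shiftPerm_spec {k d j : ℕ} (h1 : d ≤ j) (h2 : j ≤ k ^ d) :
    (∀ v ∈ truncations k d j, shiftPerm k d j v ∈ window k d j) ∧
      ∀ v, v ∉ truncations k d j ∪ window k d j → shiftPerm k d j v = v := by
  classical
  have h : (truncations k d j).card ≤ (window k d j).card :=
    (card_truncations_le k d j).trans (card_window h1 h2).ge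
  rw [shiftPerm, dif_pos h]
  exact Classical.choose_spec (exists_perm_mapsTo h)

/-! ### The time-varying network and the spread of information -/

/-- Parameters of the time-varying network: the tree `digitTree k d`, and the number `R` of
communication rounds during which information travels from one of the two distinguished vertices
without reaching the other. -/
structure Schedule where
  k : ℕ
  d : ℕ
  R : ℕ
  three_le_k : 3 ≤ k
  two_le_d : 2 ≤ d
  R_pos : 0 < R
  two_mul_half : 2 * (k ^ d / 2) = k ^ d
  dvd_half : k ^ (d - 1) ∣ k ^ d / 2
  d_mul_R_lt : d * R < k ^ d / 2

namespace Schedule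

variable (S : Schedule)

/-- The upper end of the interval of informed positions in phase `q`. -/
def upper (q : ℕ) : ℕ := if q % 2 = 0 then S.k ^ S.d else S.k ^ S.d / 2

/-- The lower end of the interval of informed positions in round `r`. -/
def lower (r : ℕ) : ℕ := S.upper (r / S.R) - 1 - S.d * (r % S.R)

/-- The arrangement of the vertices on the tree in round `r`. -/
def position : ℕ → Equiv.Perm (Fin (S.k ^ S.d))
  | 0 => 1
  | r + 1 => (position r).trans (shiftPerm S.k S.d (S.lower r))

/-- The network in round `r`. -/
def network (r : ℕ) : SimpleGraph (Fin (S.k ^ S.d)) :=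
  (digitTree S.k S.d).comap (S.position r)

/-- Vertices that may have received the information available to the source of the current phase. -/
def Informed (r : ℕ) (v : Fin (S.k ^ S.d)) : Prop :=
  S.lower r ≤ S.position r v ∧ (S.position r v : ℕ) < S.upper (r / S.R)

theorem half_le_upper (q : ℕ) : S.k ^ S.d / 2 ≤ S.upper q := by
  rw [upper]
  split_ifs <;> omega

theorem upper_le (q : ℕ) : S.upper q ≤ S.k ^ S.d := by
  rw [upper]
  split_ifs <;> omega

theorem dvd_upper (q : ℕ) : S.k ^ (S.d - 1) ∣ S.upper q := by
  rw [upper]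
  split_ifs
  · exact pow_dvd_pow _ (Nat.sub_le _ _)
  · exact S.dvd_half

theorem d_mul_mod_add_le (r : ℕ) : S.d * (r % S.R) + S.d < S.k ^ S.d / 2 := by
  have h := Nat.mod_lt r S.R_pos
  have : S.d * (r % S.R + 1) ≤ S.d * S.R := Nat.mul_le_mul_left _ h
  have := S.d_mul_R_lt
  rw [mul_add, mul_one] at *
  omega

theorem d_le_lower (r : ℕ) : S.d ≤ S.lower r := by
  have := S.d_mul_mod_add_le r
  have := S.half_le_upper (r / S.R)
  rw [lower]
  omega

theorem lower_lt (r : ℕ) : S.lower r < S.upper (r / S.R) := by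
  have := S.d_mul_mod_add_le r
  have := S.half_le_upper (r / S.R)
  rw [lower]
  omega

theorem shiftPerm_lower_spec (r : ℕ) :
    (∀ v ∈ truncations S.k S.d (S.lower r), shiftPerm S.k S.d (S.lower r) v ∈
        window S.k S.d (S.lower r)) ∧
      ∀ v, v ∉ truncations S.k S.d (S.lower r) ∪ window S.k S.d (S.lower r) →
        shiftPerm S.k S.d (S.lower r) v = v :=
  shiftPerm_spec (S.d_le_lower r) ((S.lower_lt r).le.trans (S.upper_le _))

theorem half_pos : 0 < S.k ^ S.d / 2 := (Nat.zero_le _).trans_lt S.d_mul_R_lt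

theorem half_lt : S.k ^ S.d / 2 < S.k ^ S.d := by
  have := S.two_mul_half
  have := S.half_pos
  omega

/-- The source of the even phases. -/
def evenSource : Fin (S.k ^ S.d) := ⟨S.k ^ S.d - 1, by have := S.half_lt; omega⟩

/-- The source of the odd phases. -/
def oddSource : Fin (S.k ^ S.d) := ⟨S.k ^ S.d / 2 - 1, by have := S.half_lt; omega⟩

theorem evenSource_ne_oddSource : S.evenSource ≠ S.oddSource := by
  intro h
  have := congrArg Fin.val h
  change S.k ^ S.d - 1 = S.k ^ S.d / 2 - 1 at this
  have := S.half_lt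
  have := S.half_pos
  omega

theorem shiftPerm_of_ge {r : ℕ} {v : Fin (S.k ^ S.d)} (h : S.lower r ≤ v) :
    shiftPerm S.k S.d (S.lower r) v = v := by
  refine (S.shiftPerm_lower_spec r).2 v fun hv => ?_
  rcases Finset.mem_union.1 hv with h' | h'
  · exact absurd (Finset.mem_filter.1 h').2.1 (by omega)
  · exact absurd (Finset.mem_filter.1 h').2.2 (by omega)

theorem position_evenSource (r : ℕ) : S.position r S.evenSource = S.evenSource := by
  induction r with
  | zero => rfl
  | succ r ih =>
    rw [position, Equiv.trans_apply, ih]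
    refine S.shiftPerm_of_ge ?_
    have := S.lower_lt r
    have := S.upper_le (r / S.R)
    change S.lower r ≤ S.k ^ S.d - 1
    omega

theorem position_oddSource (r : ℕ) : S.position r S.oddSource = S.oddSource := by
  induction r with
  | zero => rfl
  | succ r ih =>
    rw [position, Equiv.trans_apply, ih]
    have hval : (S.oddSource : ℕ) = S.k ^ S.d / 2 - 1 := rfl
    by_cases hq : r / S.R % 2 = 0
    · refine (S.shiftPerm_lower_spec r).2 _ fun hv => ?_
      rcases Finset.mem_union.1 hv with h' | h'
      -- The odd source sits at `-1` modulo `k`, whereas all truncations in question are multiples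
      -- of `k`.
      · obtain ⟨-, i, -, hi⟩ := (Finset.mem_filter.1 h').2
        have hk : S.k ∣ S.oddSource := by
          rw [hi]
          exact (dvd_pow_self _ (Nat.succ_ne_zero i)).trans (dvd_truncate _ _ _)
        have hk' : S.k ∣ S.k ^ S.d / 2 := by
          refine (dvd_pow_self _ ?_).trans S.dvd_half
          have := S.two_le_d
          omega
        have h1 : S.k ∣ 1 := by
          have := Nat.dvd_sub hk' hk
          rwa [hval, Nat.sub_sub_self S.half_pos] at this
        have := Nat.le_of_dvd one_pos h1
        have := S.three_le_k
        omega
      -- In an even phase the window stays in the upper half, because `d * R < k ^ d / 2`.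
      · have h1 := (Finset.mem_filter.1 h').2.1
        have h2 := S.d_mul_mod_add_le r
        have h3 := S.two_mul_half
        rw [lower, upper, if_pos hq] at h1
        omega
    · refine S.shiftPerm_of_ge ?_
      rw [lower, upper, if_neg hq]
      omega

theorem informed_evenSource {r : ℕ} (hr : r / S.R % 2 = 0) : S.Informed r S.evenSource := by
  rw [Informed, position_evenSource]
  change _ ≤ S.k ^ S.d - 1 ∧ S.k ^ S.d - 1 < _
  have := S.half_lt
  rw [lower, upper, if_pos hr]
  omega

theorem not_informed_oddSource {r : ℕ} (hr : r / S.R % 2 = 0) : ¬ S.Informed r S.oddSource := by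
  rw [Informed, position_oddSource]
  change ¬ (_ ≤ S.k ^ S.d / 2 - 1 ∧ S.k ^ S.d / 2 - 1 < _)
  have h2 := S.d_mul_mod_add_le r
  have h3 := S.two_mul_half
  rw [lower, upper, if_pos hr]
  omega

theorem informed_oddSource {r : ℕ} (hr : r / S.R % 2 = 1) : S.Informed r S.oddSource := by
  rw [Informed, position_oddSource]
  change _ ≤ S.k ^ S.d / 2 - 1 ∧ S.k ^ S.d / 2 - 1 < _
  have := S.half_pos
  rw [lower, upper, if_neg (by omega)]
  omega

theorem not_informed_evenSource {r : ℕ} (hr : r / S.R % 2 = 1) :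
    ¬ S.Informed r S.evenSource := by
  rw [Informed, position_evenSource]
  change ¬ (_ ≤ S.k ^ S.d - 1 ∧ S.k ^ S.d - 1 < _)
  have := S.half_lt
  rw [lower, upper, if_neg (by omega)]
  omega

/-- In one communication round inside a phase, information is passed to informed vertices only. -/
theorem Informed.of_adj {r : ℕ} (hr : r % S.R + 1 < S.R) {v w : Fin (S.k ^ S.d)}
    (hv : S.Informed r v) (hvw : v = w ∨ (S.network r).Adj v w) : S.Informed (r + 1) w := by
  have hmod : (r + 1) % S.R = r % S.R + 1 := by
    rw [Nat.add_mod, Nat.mod_eq_of_lt (show 1 < S.R by omega), Nat.mod_eq_of_lt hr]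
  have hdiv : (r + 1) / S.R = r / S.R := by
    rw [Nat.succ_div, if_neg, add_zero]
    intro hdvd
    have := Nat.mod_eq_zero_of_dvd hdvd
    omega
  have hd := S.d_le_lower r
  have hlow : S.lower (r + 1) = S.lower r - S.d := by
    rw [lower, lower, hmod, hdiv, mul_add, mul_one]
    omega
  have hlt := S.lower_lt r
  rw [Informed, hlow, hdiv, position, Equiv.trans_apply]
  by_cases hw : S.Informed r w
  · rw [S.shiftPerm_of_ge hw.1]
    exact ⟨by have := hw.1; omega, hw.2⟩
  · have hadj : (digitTree S.k S.d).Adj (S.position r v) (S.position r w) := by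
      rcases hvw with rfl | h
      · exact absurd hv hw
      · exact h
    have h2 := S.two_le_d
    have h := exists_eq_truncate_of_adj (by omega) (S.dvd_upper _) hadj hv.1 hv.2 hw
    have hmem := (S.shiftPerm_lower_spec r).1 _ (Finset.mem_filter.2 ⟨Finset.mem_univ _, h⟩)
    have h3 := (Finset.mem_filter.1 hmem).2
    exact ⟨h3.1, by omega⟩

theorem network_connected (r : ℕ) : (S.network r).Connected := by
  have h := S.three_le_k
  let φ : S.network r ≃g digitTree S.k S.d := ⟨S.position r, Iff.rfl⟩
  exact φ.connected_iff.2 (digitTree_connected (by omega))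

open Classical in
theorem network_degree_le (r : ℕ) (v : Fin (S.k ^ S.d)) :
    (S.network r).degree v ≤ S.d * S.k + S.d := by
  let φ : S.network r ≃g digitTree S.k S.d := ⟨S.position r, Iff.rfl⟩
  rw [← φ.degree_eq v]
  exact digitTree_degree_le _

theorem ncard_network_symmDiff_le (r : ℕ) :
    (symmDiff (S.network r).edgeSet (S.network (r + 1)).edgeSet).ncard ≤
      2 * S.d * (2 * (S.d * S.k + S.d)) := by
  classical
  set W := (truncations S.k S.d (S.lower r) ∪ window S.k S.d (S.lower r)).map
    (S.position r).symm.toEmbedding with hW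
  refine (ncard_symmDiff_edgeSet_le _ _ W (S.network_degree_le r)
    (S.network_degree_le (r + 1)) ?_).trans ?_
  · have hfix : ∀ u, u ∉ W → S.position (r + 1) u = S.position r u := by
      intro u hu
      rw [position, Equiv.trans_apply]
      refine (S.shiftPerm_lower_spec r).2 _ fun h => hu ?_
      exact Finset.mem_map.2 ⟨_, h, (S.position r).symm_apply_apply u⟩
    intro u v hu hv
    rw [network, network, SimpleGraph.comap_adj, SimpleGraph.comap_adj, hfix u hu, hfix v hv]
  · refine Nat.mul_le_mul_right _ ?_
    rw [hW, Finset.card_map]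
    refine (Finset.card_union_le _ _).trans ?_
    have h1 := card_truncations_le S.k S.d (S.lower r)
    have h2 := card_window (S.d_le_lower r) ((S.lower_lt r).le.trans (S.upper_le _))
    omega

theorem graphCond_network (r : ℕ) : graphCond (S.network r) = graphCond (digitTree S.k S.d) :=
  graphCond_comap _ _

end Schedule

/-! ### The tridiagonal quadratic and its minimizer -/

/-- The operator of the quadratic form `μ ‖x‖² + κ ∑ (x i - x (i + 1))²`. -/
def chainOp (μ κ : ℝ) : EllTwo →L[ℝ] EllTwo :=
  couplingOp μ κ swapEven + couplingOp 0 κ swapOdd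

theorem inner_chainOp (μ κ : ℝ) (x y : EllTwo) :
    ⟪chainOp μ κ x, y⟫_ℝ = ⟪x, chainOp μ κ y⟫_ℝ := by
  rw [chainOp, add_apply, add_apply, inner_add_left,
    inner_add_right, inner_couplingOp _ _ swapEven_swapEven, inner_couplingOp _ _ swapOdd_swapOdd]

theorem le_inner_chainOp (μ : ℝ) {κ : ℝ} (hκ : 0 ≤ κ) (x : EllTwo) :
    μ * ‖x‖ ^ 2 ≤ ⟪chainOp μ κ x, x⟫_ℝ := by
  rw [chainOp, add_apply, inner_add_left]
  linarith [le_inner_couplingOp μ hκ swapEven x, le_inner_couplingOp 0 hκ swapOdd x]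

theorem norm_chainOp_le {μ κ : ℝ} (hμ : 0 ≤ μ) (hκ : 0 ≤ κ) (x : EllTwo) :
    ‖chainOp μ κ x‖ ≤ (μ + 4 * κ) * ‖x‖ := by
  rw [chainOp, add_apply]
  refine (norm_add_le _ _).trans ?_
  linarith [norm_couplingOp_le hμ hκ swapEven x, norm_couplingOp_le le_rfl hκ swapOdd x]

/-- The quadratic equation for `ρ` is the recurrence at interior coordinates. As `swapOdd` fixes 0,
row 0 lacks one coupling, which leaves the multiple of the first unit vector. -/
theorem chainOp_geometric {μ κ ρ : ℝ} (h0 : 0 ≤ ρ) (h1 : ρ < 1)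
    (hρ : κ * ρ ^ 2 - (μ + 2 * κ) * ρ + κ = 0) :
    chainOp μ κ (geometric ρ h0 h1) = (μ + κ * (1 - ρ)) • lp.single 2 0 (1 : ℝ) := by
  ext i
  have hl : chainOp μ κ (geometric ρ h0 h1) i = (μ + κ) * ρ ^ i - κ * ρ ^ (swapEven i) +
      ((0 + κ) * ρ ^ i - κ * ρ ^ (swapOdd i)) := by
    rw [chainOp, add_apply, couplingOp_apply, couplingOp_apply]
    rfl
  rw [hl, lp.coeFn_smul, Pi.smul_apply, smul_eq_mul]
  rcases i with _ | i
  · rw [lp.single_apply_self, swapEven_apply, swapOdd_apply]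
    norm_num
    ring
  · rw [lp.single_apply_ne _ _ _ (Nat.succ_ne_zero i), mul_zero, swapEven_apply, swapOdd_apply]
    by_cases hi : i % 2 = 0
    · rw [if_neg (by omega), if_neg (by omega), if_pos (by omega), Nat.add_sub_cancel]
      linear_combination -(ρ ^ i) * hρ
    · rw [if_pos (by omega), if_neg (by omega), if_neg (by omega), Nat.add_sub_cancel]
      linear_combination -(ρ ^ i) * hρ

/-! ### Distribution over the vertices and the support invariant -/

namespace Schedule

variable (S : Schedule)

/-- The coupling strength of the local functions. -/
def strength (κ : ℝ) (i : Fin (S.k ^ S.d)) : ℝ :=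
  if i = S.evenSource ∨ i = S.oddSource then ((S.k ^ S.d : ℕ) : ℝ) * κ else 0

/-- The pairs of coordinates coupled by the local functions. -/
def coupling (i : Fin (S.k ^ S.d)) : Equiv.Perm ℕ :=
  if i = S.evenSource then swapOdd else swapEven

/-- The linear terms of the local functions. -/
def linearTerm (β : ℝ) (i : Fin (S.k ^ S.d)) : EllTwo :=
  if i = S.evenSource then (((S.k ^ S.d : ℕ) : ℝ) * β) • lp.single 2 0 (1 : ℝ) else 0

/-- The local functions. -/
def localFun (μ κ β : ℝ) (i : Fin (S.k ^ S.d)) : EllTwo → ℝ :=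
  quadratic (couplingOp μ (S.strength κ i) (S.coupling i)) (S.linearTerm β i)

theorem strength_nonneg {κ : ℝ} (hκ : 0 ≤ κ) (i : Fin (S.k ^ S.d)) : 0 ≤ S.strength κ i := by
  rw [strength]
  split_ifs <;> positivity

theorem coupling_coupling (i : Fin (S.k ^ S.d)) (j : ℕ) :
    S.coupling i (S.coupling i j) = j := by
  rw [coupling]
  split_ifs
  · exact swapOdd_swapOdd j
  · exact swapEven_swapEven j

/-- The problem in which the two distinguished vertices hold the two halves of a tridiagonal
quadratic function. -/
def problem (μ κ β : ℝ) (hμ : 0 < μ) (hκ : 0 ≤ κ) : Problem where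
  n := S.k ^ S.d
  graph := S.network
  connected := S.network_connected
  f := S.localFun μ κ β
  f_smooth i := ⟨_, isSmooth_quadratic (inner_couplingOp _ _ (S.coupling_coupling i)) _
    (norm_couplingOp_le hμ.le (S.strength_nonneg hκ i) _)⟩
  f_stronglyConvex i := ⟨μ, hμ, isStronglyConvex_quadratic
    (inner_couplingOp _ _ (S.coupling_coupling i)) _
    (le_inner_couplingOp μ (S.strength_nonneg hκ i) _)⟩

/-- The factor `n` at the two sources cancels the averaging in the objective. -/
theorem localFun_eq (μ κ β : ℝ) (i : Fin (S.k ^ S.d)) (x : EllTwo) :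
    S.localFun μ κ β i x = quadratic (couplingOp μ 0 swapEven) 0 x +
      ((if S.evenSource = i then ((S.k ^ S.d : ℕ) : ℝ) *
        quadratic (couplingOp 0 κ swapOdd) (β • lp.single 2 0 (1 : ℝ)) x else 0) +
      (if S.oddSource = i then ((S.k ^ S.d : ℕ) : ℝ) *
        quadratic (couplingOp 0 κ swapEven) 0 x else 0)) := by
  have hne := S.evenSource_ne_oddSource
  by_cases h1 : S.evenSource = i
  · subst h1
    rw [localFun, strength, coupling, linearTerm, if_pos (Or.inl rfl), if_pos rfl, if_pos rfl,
      if_pos rfl, if_neg hne.symm]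
    simp only [quadratic, couplingOp_apply, inner_sub_left, real_inner_smul_left, inner_zero_left]
    ring
  · by_cases h2 : S.oddSource = i
    · subst h2
      rw [localFun, strength, coupling, linearTerm, if_pos (Or.inr rfl), if_neg hne.symm,
        if_neg hne.symm, if_neg hne, if_pos rfl]
      simp only [quadratic, couplingOp_apply, inner_sub_left, real_inner_smul_left, inner_zero_left]
      ring
    · rw [localFun, strength, coupling, linearTerm,
        if_neg (not_or.2 ⟨fun h => h1 h.symm, fun h => h2 h.symm⟩), if_neg (fun h => h1 h.symm),
        if_neg (fun h => h1 h.symm), if_neg h1, if_neg h2, add_zero, add_zero]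

variable {S}

theorem objective_problem {μ κ β : ℝ} (hμ : 0 < μ) (hκ : 0 ≤ κ) :
    (S.problem μ κ β hμ hκ).objective =
      quadratic (chainOp μ κ) (β • lp.single 2 0 (1 : ℝ)) := by
  funext x
  have hn : ((S.k ^ S.d : ℕ) : ℝ) ≠ 0 := by
    have := S.half_lt
    exact_mod_cast (by omega : S.k ^ S.d ≠ 0)
  have hsum : (S.problem μ κ β hμ hκ).objective x =
      1 / ((S.k ^ S.d : ℕ) : ℝ) * ∑ i, S.localFun μ κ β i x := rfl
  rw [hsum]
  simp only [localFun_eq, Finset.sum_add_distrib, Finset.sum_ite_eq, Finset.mem_univ, if_true,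
    Finset.sum_const, Finset.card_univ, Fintype.card_fin, nsmul_eq_mul]
  rw [← mul_add, ← mul_add, ← mul_assoc, one_div, inv_mul_cancel₀ hn, one_mul]
  simp only [quadratic, chainOp, add_apply, couplingOp_apply, inner_sub_left,
    inner_add_left, real_inner_smul_left, inner_zero_left]
  ring

/-- Neither gradient oracle of a vertex leaves `firstCoords N` if the pairs of coordinates coupled
by the vertex do not cross `N`. -/
theorem gradient_localFun_mem {μ κ β : ℝ} (hμ : 0 < μ) (hκ : 0 ≤ κ) {i : Fin (S.k ^ S.d)} {N : ℕ}
    (heven : i = S.evenSource → N % 2 = 1) (hodd : i = S.oddSource → N % 2 = 0) {x : EllTwo}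
    (hx : x ∈ firstCoords N) :
    gradient (S.localFun μ κ β i) x ∈ firstCoords N ∧
      gradient (conjugate (S.localFun μ κ β i)) x ∈ firstCoords N := by
  have hA := inner_couplingOp μ (S.strength κ i) (S.coupling_coupling i)
  have hv : S.linearTerm β i ∈ firstCoords N := by
    rw [linearTerm]
    split_ifs with h
    · have := heven h
      refine Submodule.smul_mem _ _ fun j hj => ?_
      exact lp.single_apply_ne _ _ _ (by omega)
    · exact Submodule.zero_mem _
  have hσ : S.strength κ i = 0 ∨ ∀ j, N ≤ j → N ≤ S.coupling i j := by
    by_cases h1 : i = S.evenSource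
    · right
      rw [coupling, if_pos h1]
      exact le_swapOdd (heven h1)
    by_cases h2 : i = S.oddSource
    · right
      rw [coupling, if_neg h1]
      exact le_swapEven (hodd h2)
    · left
      rw [strength, if_neg (not_or.2 ⟨h1, h2⟩)]
  constructor
  · rw [localFun, gradient_quadratic hA]
    exact Submodule.sub_mem _ (couplingOp_mem_firstCoords hσ hx) hv
  · rw [localFun, gradient_conjugate_quadratic hA
      (fun y => (mul_nonneg hμ.le (sq_nonneg _)).trans
        (le_inner_couplingOp μ (S.strength_nonneg hκ i) _ y))
      (inner_couplingOp _ _ (S.coupling_coupling i))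
      (couplingOp_inverse hμ (S.strength_nonneg hκ i) (S.coupling_coupling i))]
    refine couplingOp_mem_firstCoords (hσ.imp_left fun h => ?_) (Submodule.add_mem _ hx hv)
    rw [h, zero_div, neg_zero]

theorem rounds_succ_of_not_comm {P : Problem} (A : Algorithm P) {p : ℕ} (h : ¬ A.comm p) :
    A.rounds (p + 1) = A.rounds p := by
  simp [Algorithm.rounds, roundsBefore, Nat.count_succ, h]

theorem rounds_succ_of_comm {P : Problem} (A : Algorithm P) {p : ℕ} (h : A.comm p) :
    A.rounds (p + 1) = A.rounds p + 1 := by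
  simp [Algorithm.rounds, roundsBefore, Nat.count_succ, h]

theorem rounds_le {P : Problem} (A : Algorithm P) (p : ℕ) : A.rounds p ≤ p := by
  classical
  exact Nat.count_le _

/-- In phase `q` only informed vertices can know coordinate `q`. The source able to open it is
informed from the start of the phase; the other one, which could open the next coordinate, stays
uninformed throughout. -/
theorem mem_firstCoords_of_mem_mem {μ κ β : ℝ} (hμ : 0 < μ) (hκ : 0 ≤ κ)
    (A : Algorithm (S.problem μ κ β hμ hκ)) (p : ℕ) :
    ∀ (i : Fin (S.k ^ S.d)), ∀ x ∈ A.mem p i, x ∈ firstCoords (A.rounds p / S.R + 1) ∧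
      (¬ S.Informed (A.rounds p) i → x ∈ firstCoords (A.rounds p / S.R)) := by
  induction p with
  | zero =>
    intro i x hx
    have hx' : x = 0 := by simpa [A.mem_zero i] using hx
    rw [hx']
    exact ⟨Submodule.zero_mem _, fun _ => Submodule.zero_mem _⟩
  | succ p ih =>
    intro i x hx
    by_cases hc : A.comm p
    · have hspan := A.mem_comm p hc i hx
      rw [rounds_succ_of_comm A hc]
      change x ∈ Submodule.span ℝ {z : EllTwo | ∃ j, (j = i ∨
        (S.network (A.rounds p)).Adj i j) ∧ z ∈ A.mem p j} at hspan
      have hall : x ∈ firstCoords (A.rounds p / S.R + 1) := by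
        refine Submodule.span_le.2 ?_ hspan
        rintro z ⟨j, -, hz⟩
        exact (ih j z hz).1
      have hdiv := Nat.succ_div (a := A.rounds p) (b := S.R)
      -- When a phase ends, the bound valid for all vertices becomes the bound for uninformed ones,
      -- so the informed set may restart from the next source alone.
      by_cases hdvd : S.R ∣ A.rounds p + 1
      · rw [hdiv, if_pos hdvd]
        exact ⟨firstCoords_mono (Nat.le_succ _) hall, fun _ => hall⟩
      · rw [hdiv, if_neg hdvd, add_zero]
        refine ⟨hall, fun hi => Submodule.span_le.2 ?_ hspan⟩
        have hmod : A.rounds p % S.R + 1 < S.R := by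
          have h1 := Nat.mod_lt (A.rounds p) S.R_pos
          refine lt_of_le_of_ne h1 fun h2 => hdvd ?_
          refine Nat.dvd_of_mod_eq_zero ?_
          rw [← Nat.mod_add_mod, h2, Nat.mod_self]
        rintro z ⟨j, hj, hz⟩
        refine (ih j z hz).2 fun hj' => hi (hj'.of_adj S hmod ?_)
        exact hj.imp_right fun h => h.symm
    · have hspan := A.mem_local p hc i hx
      rw [rounds_succ_of_not_comm A hc]
      change x ∈ Submodule.span ℝ {z : EllTwo | ∃ y ∈ A.mem p i, z = y ∨
        z = gradient (S.localFun μ κ β i) y ∨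
        z = gradient (conjugate (S.localFun μ κ β i)) y} at hspan
      have hstep : ∀ N, (∀ y ∈ A.mem p i, y ∈ firstCoords N) →
          (i = S.evenSource → N % 2 = 1) → (i = S.oddSource → N % 2 = 0) →
          x ∈ firstCoords N := by
        intro N hN heven hodd
        refine Submodule.span_le.2 ?_ hspan
        rintro z ⟨y, hy, rfl | rfl | rfl⟩
        · exact hN _ hy
        · exact (gradient_localFun_mem hμ hκ heven hodd (hN y hy)).1
        · exact (gradient_localFun_mem hμ hκ heven hodd (hN y hy)).2
      -- In either case a source has the parity of `N` that its couplings do not cross: the active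
      -- source works with `q + 1`, the other one with `q`.
      by_cases hi : S.Informed (A.rounds p) i
      · refine ⟨hstep _ (fun y hy => (ih i y hy).1) ?_ ?_, fun h => absurd hi h⟩
        · rintro rfl
          by_contra h
          exact S.not_informed_evenSource (by omega) hi
        · rintro rfl
          by_contra h
          exact S.not_informed_oddSource (by omega) hi
      · have hx' : x ∈ firstCoords (A.rounds p / S.R) := by
          refine hstep _ (fun y hy => (ih i y hy).2 hi) ?_ ?_
          · rintro rfl
            by_contra h
            exact hi (S.informed_evenSource (by omega))
          · rintro rfl
            have h' : ¬ A.rounds p / S.R % 2 = 1 := fun h =>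
              hi (S.informed_oddSource h)
            omega
        exact ⟨firstCoords_mono (Nat.le_succ _) hx', fun _ => hx'⟩

end Schedule

/-! ### Choice of the parameters -/

theorem exists_root_lt_one {μ κ : ℝ} (hμ : 0 < μ) (hκ : 0 ≤ κ) :
    ∃ ρ : ℝ, 0 ≤ ρ ∧ ρ < 1 ∧ κ * ρ ^ 2 - (μ + 2 * κ) * ρ + κ = 0 := by
  have hcont : ContinuousOn (fun ρ : ℝ => κ * ρ ^ 2 - (μ + 2 * κ) * ρ + κ) (Set.Icc 0 1) := by
    fun_prop
  obtain ⟨ρ, hρ, h⟩ := intermediate_value_Icc' zero_le_one hcont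
    (show (0 : ℝ) ∈ Set.Icc _ _ from ⟨by norm_num; linarith, by simpa using hκ⟩)
  refine ⟨ρ, hρ.1, lt_of_le_of_ne hρ.2 fun h1 => ?_, h⟩
  simp only [h1] at h
  linarith

/-- With `δ = √(μ / L)` the equation reads `(1 - δ²)(1 - ρ)² = 4 δ² ρ`. As `δ² < 1/24`, this gives
`1 - ρ ≤ 2.05 δ` and `ρ > 0.57`; then `4.1 ≤ 4.8 ≤ 2√6` and `2.05 / 0.57 < 4` yield the two
estimates. -/
theorem root_bounds {L μ ρ : ℝ} (hμ : 0 < μ) (hL : 24 * μ < L) (h1 : ρ < 1)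
    (hρ : (L - μ) / 4 * ρ ^ 2 - (μ + 2 * ((L - μ) / 4)) * ρ + (L - μ) / 4 = 0) :
    1 - 2 * √6 * √(μ / L) ≤ ρ ^ 2 ∧ 0 < ρ ∧ -Real.log ρ ≤ 4 * √(μ / L) ∧ √(μ / L) < 1 / 4 := by
  have hLpos : 0 < L := by linarith
  set δ := √(μ / L) with hδ
  have hδ0 : 0 < δ := Real.sqrt_pos.2 (div_pos hμ hLpos)
  have hδsq : δ ^ 2 = μ / L := Real.sq_sqrt (div_pos hμ hLpos).le
  have hμL : μ = δ ^ 2 * L := by rw [hδsq]; field_simp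
  have hδ24 : δ ^ 2 < 1 / 24 := by
    rw [hδsq, div_lt_iff₀ hLpos]
    linarith
  have hδlt : δ < 1 / 4.8 := by
    refine lt_of_pow_lt_pow_left₀ 2 (by norm_num) (hδ24.trans (by norm_num))
  have hquad : (1 - δ ^ 2) * (1 - ρ) ^ 2 = 4 * δ ^ 2 * ρ := by
    have h : L * ((1 - δ ^ 2) * (1 - ρ) ^ 2 - 4 * δ ^ 2 * ρ) = 0 := by
      rw [hμL] at hρ
      linear_combination 4 * hρ
    have := (mul_eq_zero.1 h).resolve_left hLpos.ne'
    linarith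
  have hle : 1 - ρ ≤ 2.05 * δ := by
    refine le_of_pow_le_pow_left₀ two_ne_zero (by positivity) ?_
    nlinarith [mul_nonneg (sq_nonneg δ) (sub_nonneg.2 h1.le), sq_nonneg (1 - ρ),
      mul_nonneg (sub_nonneg.2 hδ24.le) (sq_nonneg (1 - ρ))]
  have hρpos : 0.57 < ρ := by
    norm_num at hδlt hle ⊢
    linarith
  have h6 : 2.4 ≤ √6 := Real.le_sqrt_of_sq_le (by norm_num)
  refine ⟨?_, by linarith, ?_, by norm_num at hδlt; linarith⟩
  · nlinarith [sq_nonneg (1 - ρ), mul_le_mul_of_nonneg_right h6 hδ0.le]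
  · have hlog := Real.log_le_sub_one_of_pos (inv_pos.2 (by linarith : 0 < ρ))
    rw [Real.log_inv] at hlog
    refine hlog.trans ?_
    rw [sub_le_iff_le_add, inv_le_iff_one_le_mul₀ (by linarith)]
    nlinarith

/-- Schedules with arbitrarily large trees of given depth, in which information needs a time
proportional to the number of vertices. -/
theorem exists_schedule {d : ℕ} (hd : 2 ≤ d) (B : ℝ) :
    ∃ S : Schedule, S.d = d ∧ B < ((S.k - 1 : ℕ) : ℝ) ∧ S.k ^ S.d ≤ 4 * (d * S.R) := by
  obtain ⟨h, hh⟩ := exists_nat_gt (max B (4 * d))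
  have hB : B < h := (le_max_left _ _).trans_lt hh
  have h4d : 4 * d < h := by exact_mod_cast (le_max_right _ _).trans_lt hh
  obtain ⟨e, rfl⟩ : ∃ e, d = e + 1 := ⟨d - 1, by omega⟩
  have hpow : (2 * h) ^ (e + 1) = 2 * (h * (2 * h) ^ e) := by ring
  have hhalf : (2 * h) ^ (e + 1) / 2 = h * (2 * h) ^ e := by omega
  have hge : h ≤ h * (2 * h) ^ e := Nat.le_mul_of_pos_right _ (pow_pos (by omega) _)
  set m := h * (2 * h) ^ e with hm
  have hdiv := Nat.div_add_mod (m - 1) (e + 1)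
  have hmod := Nat.mod_lt (m - 1) (show e + 1 > 0 by omega)
  -- An even base `k = 2h` makes half of `k ^ d` a multiple of `k ^ (d - 1)`. `R` is the largest
  -- number with `d * R` below that half, and `h > 4d` makes the rounding loss harmless.
  refine ⟨⟨2 * h, e + 1, (m - 1) / (e + 1), by omega, hd, Nat.div_pos (by omega) (by omega),
    by omega, ?_, by omega⟩, rfl, ?_, ?_⟩
  · rw [hhalf, hm, Nat.add_sub_cancel]
    exact Dvd.intro_left _ rfl
  · refine hB.trans_le ?_
    exact_mod_cast (by change h ≤ 2 * h - 1; omega)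
  · change (2 * h) ^ (e + 1) ≤ 4 * ((e + 1) * ((m - 1) / (e + 1)))
    omega

end DecOpt

end

/-! ### The lower bounds -/

theorem theorem1 (α c : ℝ) (hα : 0 < α) (hc : 0 < c) :
    ∃ K C ε₀ : ℝ, 0 < K ∧ 0 < C ∧ 0 < ε₀ ∧ ε₀ < 1 ∧
      ∀ L μ M : ℝ, 0 < μ → μ ≤ L → 0 < M →
        ∃ P : DecOpt.Problem,
          DecOpt.IsSmooth L P.objective ∧
          DecOpt.IsStronglyConvex μ P.objective ∧
          M < (P.n : ℝ) ∧
          M < P.chi ∧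
          (P.edgeChange : ℝ) ≤ c * (P.n : ℝ) ^ α ∧
          ∃ xstar : DecOpt.EllTwo,
            (∀ y, P.objective xstar ≤ P.objective y) ∧
            xstar ≠ 0 ∧
            ∀ A : DecOpt.Algorithm P, ∀ p : ℕ, ∀ i : Fin P.n, ∀ x ∈ A.mem p i,
              (max 0 (1 - 2 * √6 * √(μ / L))) ^ (K * (p : ℝ) / P.chi + 2)
                  * ‖(0 : DecOpt.EllTwo) - xstar‖ ^ 2 ≤ ‖x - xstar‖ ^ 2 ∧
              (24 * μ < L → ∀ ε : ℝ, 0 < ε → ε < ε₀ →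
                ‖x - xstar‖ ^ 2 ≤ ε * ‖(0 : DecOpt.EllTwo) - xstar‖ ^ 2 →
                C * P.chi * √(L / μ) * Real.log (1 / ε) ≤ (A.rounds p : ℝ)) := by
  -- `d ≥ 2/α` ensures `k² ≤ n ^ α`, one factor `k` more than the edge changes need; the spare
  -- factor absorbs `8d²/c`.
  obtain ⟨d, hd⟩ := exists_nat_gt (max 2 (2 / α))
  have hd2 : 2 < d := by exact_mod_cast (le_max_left _ _).trans_lt hd
  have hdα : 2 ≤ d * α := by
    have := (le_max_right _ _).trans_lt hd
    rw [div_lt_iff₀ hα] at this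
    exact this.le
  have hd0 : (0 : ℝ) < d := by exact_mod_cast (by omega : 0 < d)
  -- Here `32 d⁴ = 8 d³ · 4 d`, from `χ ≤ 8 d³ n` and `n ≤ 4 d R`.
  set K : ℝ := 32 * (d : ℝ) ^ 4 with hK
  have hK0 : 0 < K := by positivity
  refine ⟨K, 1 / (16 * K), Real.exp (-4), hK0, by positivity, Real.exp_pos _,
    Real.exp_lt_one_iff.2 (by norm_num), ?_⟩
  intro L μ M hμ hμL hM
  have hL0 : 0 < L := hμ.trans_le hμL
  obtain ⟨S, hSd, hSk, hSR⟩ := DecOpt.exists_schedule hd2.le (max M (8 * d ^ 2 / c))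
  have hκ : 0 ≤ (L - μ) / 4 := by linarith
  obtain ⟨ρ, h0, h1, hρ⟩ := DecOpt.exists_root_lt_one hμ hκ
  set κ := (L - μ) / 4 with hκdef
  set P := S.problem μ κ (μ + κ * (1 - ρ)) hμ hκ with hP
  have hobj : P.objective = _ := DecOpt.Schedule.objective_problem hμ hκ
  have hn : P.n = S.k ^ S.d := rfl
  have hk3 := S.three_le_k
  have hchi : P.chi = DecOpt.graphCond (DecOpt.digitTree S.k S.d) := by
    have : ∀ r, DecOpt.graphCond (P.graph r) = _ := S.graphCond_network
    rw [DecOpt.Problem.chi]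
    simp only [this]
    exact ciSup_const
  have hchiM : M < P.chi := by
    rw [hchi]
    exact ((le_max_left _ _).trans_lt hSk).trans_le
      (DecOpt.le_graphCond_digitTree hk3 (by omega))
  have hchi0 : 0 < P.chi := hM.trans hchiM
  have hR0 : (0 : ℝ) < S.R := by exact_mod_cast S.R_pos
  have hchiR : P.chi ≤ K * S.R := by
    rw [hchi]
    refine (DecOpt.graphCond_digitTree_le hk3 (by omega)).trans ?_
    have : ((S.k ^ S.d : ℕ) : ℝ) ≤ 4 * (d * S.R) := by exact_mod_cast hSR
    rw [hSd] at this ⊢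
    calc 8 * (d : ℝ) ^ 3 * ((S.k ^ d : ℕ) : ℝ) ≤ 8 * (d : ℝ) ^ 3 * (4 * (d * S.R)) := by gcongr
      _ = K * S.R := by rw [hK]; ring
  have hkn : S.k ≤ S.k ^ S.d := Nat.le_self_pow (by omega) _
  have hkreal : max M (8 * d ^ 2 / c) < (S.k : ℝ) :=
    hSk.trans_le (by exact_mod_cast Nat.sub_le _ _)
  refine ⟨P, ?_, ?_, ?_, hchiM, ?_, DecOpt.geometric ρ h0 h1, ?_,
    DecOpt.geometric_ne_zero h0 h1, ?_⟩
  · rw [hobj]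
    refine DecOpt.isSmooth_quadratic (DecOpt.inner_chainOp μ κ) _ fun x => ?_
    refine (DecOpt.norm_chainOp_le hμ.le hκ x).trans (le_of_eq ?_)
    rw [hκdef]
    ring
  · rw [hobj]
    exact DecOpt.isStronglyConvex_quadratic (DecOpt.inner_chainOp μ κ) _
      (DecOpt.le_inner_chainOp μ hκ)
  · exact ((le_max_left _ _).trans_lt hkreal).trans_le (by exact_mod_cast hkn)
  · have hchange : P.edgeChange ≤ 2 * S.d * (2 * (S.d * S.k + S.d)) :=
      ciSup_le fun r => S.ncard_network_symmDiff_le r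
    have hk1 : (1 : ℝ) ≤ S.k := by exact_mod_cast (by omega : 1 ≤ S.k)
    have h8 : 8 * (d : ℝ) ^ 2 ≤ c * S.k := by
      have := ((le_max_right _ _).trans_lt hkreal).le
      rw [div_le_iff₀ hc] at this
      linarith
    have hpow : (S.k : ℝ) ^ 2 ≤ (P.n : ℝ) ^ α := by
      rw [hn, hSd, Nat.cast_pow, ← Real.rpow_natCast (S.k : ℝ) d, ← Real.rpow_mul (by positivity),
        ← Real.rpow_natCast (S.k : ℝ) 2]
      exact Real.rpow_le_rpow_of_exponent_le hk1 (by exact_mod_cast hdα)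
    calc (P.edgeChange : ℝ) ≤ ((2 * S.d * (2 * (S.d * S.k + S.d)) : ℕ) : ℝ) := by
          exact_mod_cast hchange
      _ = 4 * (d : ℝ) ^ 2 * (S.k + 1) := by rw [hSd]; push_cast; ring
      _ ≤ 4 * (d : ℝ) ^ 2 * (S.k + S.k) := by gcongr
      _ = 8 * (d : ℝ) ^ 2 * S.k := by ring
      _ ≤ c * S.k * S.k := by gcongr
      _ = c * (S.k : ℝ) ^ 2 := by ring
      _ ≤ c * (P.n : ℝ) ^ α := by gcongr
  · intro y
    rw [hobj]
    exact DecOpt.quadratic_le_of_apply_eq (DecOpt.inner_chainOp μ κ)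
      (fun x => (mul_nonneg hμ.le (sq_nonneg _)).trans (DecOpt.le_inner_chainOp μ hκ x))
      (DecOpt.chainOp_geometric h0 h1 hρ) y
  intro A p i x hx
  set N := A.rounds p / S.R + 1 with hN
  have hdist := DecOpt.dist_geometric_ge h0 h1
    (DecOpt.Schedule.mem_firstCoords_of_mem_mem hμ hκ A p i x hx).1
  rw [zero_sub, norm_neg]
  have hNr : (N : ℝ) ≤ (A.rounds p : ℝ) / S.R + 1 := by
    rw [hN]
    push_cast
    linarith [Nat.cast_div_le (α := ℝ) (m := A.rounds p) (n := S.R)]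
  constructor
  · refine le_trans (mul_le_mul_of_nonneg_right ?_ (sq_nonneg _)) hdist
    have hexp : (N : ℝ) ≤ K * p / P.chi + 2 := by
      have hr : (A.rounds p : ℝ) ≤ p := by exact_mod_cast DecOpt.Schedule.rounds_le A p
      have h2 : (A.rounds p : ℝ) / S.R ≤ K * p / P.chi := by
        rw [div_le_div_iff₀ hR0 hchi0]
        calc (A.rounds p : ℝ) * P.chi ≤ p * (K * S.R) := by gcongr
          _ = K * p * S.R := by ring
      linarith
    have hexp0 : 0 < K * p / P.chi + 2 := by positivity
    rcases le_or_gt L (24 * μ) with hL | hL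
    -- For `L ≤ 24 μ` the base is nonpositive and, the exponent being positive, the bound is
    -- trivial.
    · have hbase : 1 - 2 * √6 * √(μ / L) ≤ 0 := by
        rw [mul_assoc, ← Real.sqrt_mul (by norm_num)]
        have : 1 / 2 ≤ √(6 * (μ / L)) := by
          refine Real.le_sqrt_of_sq_le ?_
          rw [← mul_div_assoc, le_div_iff₀ hL0]
          linarith
        linarith
      rw [max_eq_left hbase, Real.zero_rpow hexp0.ne']
      positivity
    · obtain ⟨hb, hρ0, -, -⟩ := DecOpt.root_bounds hμ hL h1 hρ
      rcases le_or_gt (1 - 2 * √6 * √(μ / L)) 0 with hbase | hbase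
      · rw [max_eq_left hbase, Real.zero_rpow hexp0.ne']
        positivity
      · rw [max_eq_right hbase.le]
        have hb1 : 1 - 2 * √6 * √(μ / L) ≤ 1 := by
          have : 0 ≤ 2 * √6 * √(μ / L) := by positivity
          linarith
        calc (1 - 2 * √6 * √(μ / L)) ^ (K * p / P.chi + 2)
            ≤ (1 - 2 * √6 * √(μ / L)) ^ (N : ℝ) :=
              Real.rpow_le_rpow_of_exponent_ge hbase hb1 hexp
          _ = (1 - 2 * √6 * √(μ / L)) ^ N := Real.rpow_natCast _ _
          _ ≤ (ρ ^ 2) ^ N := pow_le_pow_left₀ hbase.le hb _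
          _ = ρ ^ (2 * N) := by rw [← pow_mul]
  · intro hL ε hε hε0 hxε
    obtain ⟨-, hρ0, hlogρ, hδ4⟩ := DecOpt.root_bounds hμ hL h1 hρ
    have hg0 : 0 < ‖DecOpt.geometric ρ h0 h1‖ ^ 2 :=
      pow_pos (norm_pos_iff.2 (DecOpt.geometric_ne_zero h0 h1)) 2
    have hρε : ρ ^ (2 * N) ≤ ε := le_of_mul_le_mul_right (hdist.trans hxε) hg0
    have hδinv : √(L / μ) = (√(μ / L))⁻¹ := by rw [← Real.sqrt_inv, inv_div]
    set δ := √(μ / L) with hδ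
    have hδ0 : 0 < δ := Real.sqrt_pos.2 (div_pos hμ hL0)
    set ℓ := Real.log (1 / ε) with hℓ
    have hℓ' : ℓ = -Real.log ε := by rw [hℓ, one_div, Real.log_inv]
    have hℓ4 : 4 < ℓ := by
      have := Real.log_lt_log hε hε0
      rw [Real.log_exp] at this
      linarith
    have hℓN : ℓ ≤ 8 * δ * N := by
      have h2 := Real.log_le_log (pow_pos hρ0 _) hρε
      rw [Real.log_pow] at h2
      push_cast at h2
      have : 2 * (N : ℝ) * -Real.log ρ ≤ 2 * N * (4 * δ) := by gcongr
      linarith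
    have hmain : ℓ / (16 * δ) ≤ (A.rounds p : ℝ) / S.R := by
      have h3 : ℓ / (8 * δ) ≤ (A.rounds p : ℝ) / S.R + 1 := by
        rw [div_le_iff₀ (by positivity)]
        have : 8 * δ * N ≤ 8 * δ * ((A.rounds p : ℝ) / S.R + 1) := by gcongr
        linarith
      -- The choice `ε₀ = exp (-4)` gives `ℓ > 4 > 16 δ`; half of `ℓ / (8δ)` thus absorbs the
      -- additive 1 in `N`.
      have h4 : 1 ≤ ℓ / (16 * δ) := by
        rw [le_div_iff₀ (by positivity)]
        linarith
      have h5 : ℓ / (8 * δ) = 2 * (ℓ / (16 * δ)) := by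
        field_simp
        norm_num
      linarith
    rw [le_div_iff₀ hR0] at hmain
    refine le_trans ?_ hmain
    rw [hδinv]
    calc 1 / (16 * K) * P.chi * δ⁻¹ * ℓ ≤ 1 / (16 * K) * (K * S.R) * δ⁻¹ * ℓ := by gcongr
      _ = ℓ / (16 * δ) * S.R := by field_simp
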